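/- **Setting.** Let $D$ be a nonzero associative ring with identity. Let $(I,I')$ be a polarized artinian poset, that is, a poset $I$ with the descending chain condition together with a lower subset $I'\subseteq I$, and assume that $I$ has at least two elements. All products, powers and differences of ordinals below are ordinal operations; $\beta-\alpha$ is the ordinal with $\beta=\alpha+(\beta-\alpha)$; an ordinal is identified with the set of smaller ordinals and a cardinal with its initial ordinal. *The index set.* Put $I_0=\emptyset$, $I_{\alpha+1}=I_\alpha\cup\min(I\setminus I_\alpha)$, $I_\alpha=\bigcup_{\beta<\alpha}I_\beta$ for limit $\alpha$, and let $\xi$ be the least ordinal with $I_{\xi+1}=I_\xi$. Let $\lambda(i)=\lambda_I(i)+1$, where $\lambda_I(i)=\sup\{\lambda_I(j)+1: j<i\}$ (so $\lambda_I(i)=0$ for $i$ minimal); then $\lambda(i)\le\xi$. Let $\beth$ be the number of maximal chains of $I$, let $\aleph$ be the least infinite cardinal with $\aleph\ge|I|$ and $\aleph\ge\beth$, and let $X=\aleph^{\xi+1}\beth$. For $\alpha\le\xi+1$ and $l<\aleph^{\xi+1-\alpha}\beth$ let $X_{\alpha,l}=[\aleph^\alpha l,\aleph^\alpha l+\aleph^\alpha)$;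 these sets form a partition $\mathcal P_\alpha$ of $X$. For $x\in X$ write $x=\aleph^\alpha x_{\alpha,q}+x_{\alpha,r}$ with $x_{\alpha,r}<\aleph^\alpha$. *Matrices.* For a set $S$ let $\mathrm{CFM}_S(D)$ be the ring of $S\times S$ matrices over $D$ all of whose columns have finite support, and let $\mathrm{FR}_S(D)$ and $\mathrm{FM}_S(D)$ be its subsets of matrices with finitely many nonzero rows, respectively entries. Let $Q=\mathrm{CFM}_X(D)$, with $D$ embedded as the scalar matrices, and for $Y\subseteq X$ let $e_Y\in Q$ be the diagonal idempotent with $e_Y(x,x)=1$ exactly for $x\in Y$. For $\alpha\le\xi+1$ define $\varphi_\alpha:\mathrm{CFM}_{\aleph^{\xi+1-\alpha}\beth}(D)\to Q$ by $\varphi_\alpha(a)(x,y)=\delta(x_{\alpha,r},y_{\alpha,r})\,a(x_{\alpha,q},y_{\alpha,q})$, and let $F_\alpha$ and $G_\alpha$ be the images under $\varphi_\alpha$ of $\mathrm{FR}$ and $\mathrm{FM}$. *Choices and maps.* Fix a bijection $\chi\mapsto A_\chi$ from $\beth$ to the set of maximal chains of $I$. For $i\in I$ let $\mathbb D_i$ be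 the set of classes of maximal chains containing $i$ under the relation $A\sim_iB\iff A\cap\{\le i\}=B\cap\{\le i\}$. For $\mathcal A\in\mathbb D_i$ let $\beth_{\mathcal A}=\{\chi<\beth: A_\chi\in\mathcal A\}$, $X_{\mathcal A}=\bigcup_{\chi\in\beth_{\mathcal A}}X_{\xi+1,\chi}$, $X_i=\bigcup_{\mathcal A\in\mathbb D_i}X_{\mathcal A}$ and $\Lambda_{\mathcal A}=\{l<\aleph^{\xi+1-\lambda(i)}\beth: X_{\lambda(i),l}\subseteq X_{\mathcal A}\}$. For $\mathcal A,\mathcal A'\in\mathbb D_i$ let $g_{\mathcal A'\mathcal A}:\beth_{\mathcal A}\to\beth_{\mathcal A'}$ be the bijection with $A_{g_{\mathcal A'\mathcal A}(\chi)}=(A'\cap\{\le i\})\cup(A_\chi\cap\{\ge i\})$ for any $A'\in\mathcal A'$, and let $k_{\mathcal A'\mathcal A}:\Lambda_{\mathcal A}\to\Lambda_{\mathcal A'}$ send $\aleph^{\xi+1-\lambda(i)}\chi+\sigma$ to $\aleph^{\xi+1-\lambda(i)}g_{\mathcal A'\mathcal A}(\chi)+\sigma$ (where $\chi\in\beth_{\mathcal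 A}$, $\sigma<\aleph^{\xi+1-\lambda(i)}$). For each $i$ fix a class $\mathcal A_i\in\mathbb D_i$ and a bijection $k_{\mathcal A_i}:\Lambda_{\mathcal A_i}\to\aleph^{\xi+1-\lambda(i)}\beth$, put $k_{\mathcal A}=k_{\mathcal A_i}k_{\mathcal A_i\mathcal A}$, and let $t_{\mathcal A}:X_{\mathcal A}\to X$ be the bijection $\aleph^{\lambda(i)}l+\rho\mapsto\aleph^{\lambda(i)}k_{\mathcal A}(l)+\rho$ ($l\in\Lambda_{\mathcal A}$, $\rho<\aleph^{\lambda(i)}$). Define $\psi_i:Q\to Q$ by $\psi_i(a)(x,y)=a(t_{\mathcal A}(x),t_{\mathcal A}(y))$ if $x,y\in X_{\mathcal A}$ for some (necessarily unique) $\mathcal A\in\mathbb D_i$, and $\psi_i(a)(x,y)=0$ otherwise. For $Y\in\mathcal P_{\lambda(i)}$ let $Y(i)=\bigcup_{\mathcal A\in\mathbb D_i}t_{\mathcal A}^{-1}(Y)$. Finally let $$H_i=\begin{cases}\psi_i(D)=e_{X_i}D,& i\text{ maximal},\\ \psi_i(F_{\lambda(i)}),& i\text{ not maximal},\ i\in I',\\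 \psi_i(G_{\lambda(i)}),& i\text{ not maximal},\ i\notin I'.\end{cases}$$ **Theorem.** For every choice of the data above, $\{H_i\mid i\in I\}$ is an independent family of $(D,D)$-submodules of $Q$, and the following hold. 1. Every $H_i$ is closed under multiplication. It contains the identity of $Q$ if and only if $i$ is the greatest element of $I$. It has a multiplicative identity of its own if and only if $i$ is a maximal element of $I$, and in that case the identity is $e_{X_i}$. 2. If $i,j\in I$ are not comparable, then $H_iH_j=0$. 3. Let $i\in I$, let $J\subseteq\{j\in I: i\le j\}$ and let $0\ne a\in\bigoplus_{j\in J}H_j$. Then $0\neq H_ia\subseteq H_i$ and $0\ne aH_i\subseteq H_i$. Moreover there are $Y,Z\in\mathcal P_{\lambda(i)}$ such that $e_{Y(i)}a\ne0$ and $ae_{Z(i)}\neq0$, and such that, if $i$ is not maximal, the elements $e_{Y(i)}$, $e_{Z(i)}$, $e_{Y(i)}a$ and $ae_{Z(i)}$ all belong to $H_i$. -/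

import Mathlib

noncomputable section

universe u v w

/-- Column-finite `X × X` matrices over `D`: every column `y` has only finitely many nonzero
entries `x ↦ a x y`. -/
@[ext]
structure CFM (X : Type w) (D : Type v) [Ring D] where
  entry : X → X → D
  finite_col : ∀ y, {x | entry x y ≠ 0}.Finite

namespace CFM

variable {X : Type w} {D : Type v} [Ring D]

instance : CoeFun (CFM X D) (fun _ => X → X → D) := ⟨CFM.entry⟩

theorem ext' {a b : CFM X D} (h : ∀ x y, a x y = b x y) : a = b :=
  CFM.ext (funext fun x => funext fun y => h x y)

instance : Zero (CFM X D) := ⟨⟨fun _ _ => 0, fun _ => by simp⟩⟩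

instance : Add (CFM X D) := ⟨fun a b => ⟨fun x y => a x y + b x y, fun y =>
  ((a.finite_col y).union (b.finite_col y)).subset (by
    intro x hx
    by_contra h
    simp only [Set.mem_union, Set.mem_ofPred_eq, not_or, not_not] at h
    exact hx (by rw [h.1, h.2, add_zero]))⟩⟩

instance : Neg (CFM X D) := ⟨fun a => ⟨fun x y => -a x y, fun y => by
  simpa using a.finite_col y⟩⟩

/-- The row-by-column product; for fixed `x, y` only finitely many `z` contribute. -/
instance : Mul (CFM X D) := ⟨fun a b => ⟨fun x y => ∑ᶠ z, a x z * b z y, fun y => by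
  refine ((b.finite_col y).biUnion (fun z _ => a.finite_col z)).subset ?_
  intro x hx
  obtain ⟨z, hz⟩ : ∃ z, a x z * b z y ≠ 0 := by
    by_contra h
    push Not at h
    exact hx (by simp [h])
  simp only [Set.mem_iUnion]
  exact ⟨z, right_ne_zero_of_mul hz, left_ne_zero_of_mul hz⟩⟩⟩

open Classical in
/-- The scalar matrix with diagonal entry `d`. -/
def scalarFun (d : D) : CFM X D :=
  ⟨fun x y => if x = y then d else 0, fun y => (Set.finite_singleton y).subset (by
    intro x hx
    by_contra h
    exact hx (if_neg h))⟩

instance : One (CFM X D) := ⟨scalarFun 1⟩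

@[simp] theorem zero_entry (x y : X) : (0 : CFM X D) x y = 0 := rfl

@[simp] theorem add_entry (a b : CFM X D) (x y : X) : (a + b) x y = a x y + b x y := rfl

@[simp] theorem neg_entry (a : CFM X D) (x y : X) : (-a) x y = -a x y := rfl

theorem mul_entry (a b : CFM X D) (x y : X) : (a * b) x y = ∑ᶠ z, a x z * b z y := rfl

open Classical in
theorem scalarFun_entry (d : D) (x y : X) :
    (scalarFun d : CFM X D) x y = if x = y then d else 0 := rfl

open Classical in
theorem one_entry (x y : X) : (1 : CFM X D) x y = if x = y then 1 else 0 := rfl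

theorem mul_entry_eq_sum (a b : CFM X D) (x y : X) (s : Finset X)
    (hs : ∀ z, b z y ≠ 0 → z ∈ s) : (a * b) x y = ∑ z ∈ s, a x z * b z y := by
  rw [mul_entry]
  refine finsum_eq_sum_of_support_subset _ ?_
  intro z hz
  exact hs z (right_ne_zero_of_mul hz)

theorem scalarFun_mul_entry (d : D) (a : CFM X D) (x y : X) :
    (scalarFun d * a : CFM X D) x y = d * a x y := by
  rw [mul_entry, finsum_eq_single _ x]
  · simp [scalarFun_entry]
  · intro z hz
    simp [scalarFun_entry, Ne.symm hz]

theorem mul_scalarFun_entry (d : D) (a : CFM X D) (x y : X) :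
    (a * scalarFun d : CFM X D) x y = a x y * d := by
  rw [mul_entry, finsum_eq_single _ y]
  · simp [scalarFun_entry]
  · intro z hz
    simp [scalarFun_entry, hz]

theorem mul_assoc' (a b c : CFM X D) : a * b * c = a * (b * c) := by
  classical
  refine ext' fun x y => ?_
  set s := (c.finite_col y).toFinset with hs
  set t := s.biUnion (fun z => (b.finite_col z).toFinset) with ht
  have h1 : ∀ w, (b * c) w y = ∑ z ∈ s, b w z * c z y := fun w =>
    mul_entry_eq_sum b c w y s (by simp [hs])
  rw [mul_entry_eq_sum (a * b) c x y s (by simp [hs]),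
    mul_entry_eq_sum a (b * c) x y t]
  · have h2 : ∀ z ∈ s, (a * b) x z * c z y = ∑ w ∈ t, a x w * b w z * c z y := by
      intro z hz
      rw [mul_entry_eq_sum a b x z t, Finset.sum_mul]
      intro w hw
      exact Finset.mem_biUnion.2 ⟨z, hz, by simpa using hw⟩
    rw [Finset.sum_congr rfl h2, Finset.sum_comm]
    refine Finset.sum_congr rfl fun w _ => ?_
    rw [h1, Finset.mul_sum]
    exact Finset.sum_congr rfl fun z _ => mul_assoc _ _ _
  · intro w hw
    rw [h1] at hw
    obtain ⟨z, hz, hne⟩ := Finset.exists_ne_zero_of_sum_ne_zero hw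
    exact Finset.mem_biUnion.2 ⟨z, hz, by simpa using left_ne_zero_of_mul hne⟩

theorem mul_add' (a b c : CFM X D) : a * (b + c) = a * b + a * c := by
  classical
  refine ext' fun x y => ?_
  set s := (b.finite_col y).toFinset ∪ (c.finite_col y).toFinset with hs
  rw [add_entry, mul_entry_eq_sum a b x y s (by intro z hz; simp [hs, hz]),
    mul_entry_eq_sum a c x y s (by intro z hz; simp [hs, hz]), mul_entry_eq_sum a (b + c) x y s]
  · rw [← Finset.sum_add_distrib]
    exact Finset.sum_congr rfl fun z _ => by rw [add_entry, mul_add]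
  · intro z hz
    by_contra h
    simp only [hs, Finset.mem_union, Set.Finite.mem_toFinset, Set.mem_ofPred_eq, not_or,
      not_not] at h
    exact hz (by rw [add_entry, h.1, h.2, add_zero])

theorem add_mul' (a b c : CFM X D) : (a + b) * c = a * c + b * c := by
  refine ext' fun x y => ?_
  set s := (c.finite_col y).toFinset with hs
  have hc : ∀ z, c z y ≠ 0 → z ∈ s := by simp [hs]
  rw [add_entry, mul_entry_eq_sum _ _ x y s hc, mul_entry_eq_sum _ _ x y s hc,
    mul_entry_eq_sum _ _ x y s hc, ← Finset.sum_add_distrib]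
  exact Finset.sum_congr rfl fun z _ => by rw [add_entry, add_mul]

instance : Ring (CFM X D) where
  add_assoc a b c := ext' fun x y => add_assoc _ _ _
  zero_add a := ext' fun x y => zero_add _
  add_zero a := ext' fun x y => add_zero _
  add_comm a b := ext' fun x y => add_comm _ _
  neg_add_cancel a := ext' fun x y => neg_add_cancel _
  mul_assoc := mul_assoc'
  left_distrib := mul_add'
  right_distrib := add_mul'
  one_mul a := ext' fun x y => (scalarFun_mul_entry 1 a x y).trans (one_mul _)
  mul_one a := ext' fun x y => (mul_scalarFun_entry 1 a x y).trans (mul_one _)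
  zero_mul a := ext' fun x y => by simp [mul_entry]
  mul_zero a := ext' fun x y => by simp [mul_entry]
  nsmul := nsmulRec
  zsmul := zsmulRec

/-- The embedding of `D` into the matrix ring as the ring of scalar matrices. -/
def scalar (X : Type w) (D : Type v) [Ring D] : D →+* CFM X D where
  toFun := scalarFun
  map_one' := rfl
  map_zero' := ext' fun x y => by simp [scalarFun_entry]
  map_add' d e := ext' fun x y => by
    by_cases h : x = y <;> simp [scalarFun_entry, h]
  map_mul' d e := ext' fun x y => by
    rw [scalarFun_mul_entry]
    by_cases h : x = y <;> simp [scalarFun_entry, h]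

open Classical in
/-- The diagonal idempotent `e_Y` of a subset `Y` of the index set. -/
def idem (D : Type v) [Ring D] (Y : Set X) : CFM X D :=
  ⟨fun x y => if x = y ∧ x ∈ Y then 1 else 0, fun y => (Set.finite_singleton y).subset (by
    intro x hx
    by_contra h
    exact hx (if_neg fun h' => h h'.1))⟩

/-- The matrices with only finitely many nonzero rows. -/
def finRows (X : Type w) (D : Type v) [Ring D] : AddSubgroup (CFM X D) where
  carrier := {a | {x | ∃ y, a x y ≠ 0}.Finite}
  zero_mem' := by simp
  add_mem' {a b} ha hb := by
    refine (Set.Finite.union ha hb).subset ?_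
    rintro x ⟨y, hy⟩
    by_contra h
    simp only [Set.mem_union, Set.mem_ofPred_eq, not_or, not_exists, not_not] at h
    exact hy (by rw [add_entry, h.1, h.2, add_zero])
  neg_mem' {a} ha := by simpa using ha

/-- The matrices with only finitely many nonzero entries. -/
def finEntries (X : Type w) (D : Type v) [Ring D] : AddSubgroup (CFM X D) where
  carrier := {a | {p : X × X | a p.1 p.2 ≠ 0}.Finite}
  zero_mem' := by simp
  add_mem' {a b} ha hb := by
    refine (Set.Finite.union ha hb).subset ?_
    rintro p hp
    by_contra h
    simp only [Set.mem_union, Set.mem_ofPred_eq, not_or, not_not] at h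
    exact hp (by rw [add_entry, h.1, h.2, add_zero])
  neg_mem' {a} ha := by simpa using ha

end CFM

namespace PosetRing

section Order

variable (I : Type u) [PartialOrder I]

/-- The dual classical Krull filtration: `I_0 = ∅`, `I_(α+1)` adds to `I_α` the minimal elements
of the complement of `I_α`, and unions are taken at limit ordinals. -/
def krullFiltration (α : Ordinal.{u}) : Set I :=
  Ordinal.limitRecOn α ∅ (fun _ S => S ∪ {i | Minimal (fun j => j ∉ S) i})
    (fun α _ S => ⋃ β : Set.Iio α, S β.1 β.2)

/-- The dual classical Krull dimension. -/
def krullDim : Ordinal.{u} :=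
  sInf {α | krullFiltration I (α + 1) = krullFiltration I α}

/-- The cardinal number of the set of maximal chains (`Flag I` is the type of maximal chains),
as an initial ordinal. -/
def beth : Ordinal.{u} := (Cardinal.mk (Flag I)).ord

/-- The first infinite cardinal which is at least the cardinality of the poset and at least the
number of its maximal chains, as an initial ordinal. -/
def aleph : Ordinal.{u} :=
  (max Cardinal.aleph0 (max (Cardinal.mk I) (Cardinal.mk (Flag I)))).ord

/-- The set of ordinals below `ℵ ^ (ξ + 1 - α) * ℶ` (ordinal arithmetic). -/
abbrev Idx (α : Ordinal.{u}) : Type (u + 1) :=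
  Set.Iio (aleph I ^ (krullDim I + 1 - α) * beth I)

/-- The ordinal `X = ℵ ^ (ξ + 1) * ℶ`, as the set of all smaller ordinals. -/
abbrev Pt : Type (u + 1) :=
  Set.Iio (aleph I ^ (krullDim I + 1) * beth I)

/-- The block `X_(α, l) = [ℵ ^ α * l, ℵ ^ α * l + ℵ ^ α)` of `X`. -/
def block (α l : Ordinal.{u}) : Set (Pt I) :=
  {x | aleph I ^ α * l ≤ x.1 ∧ x.1 < aleph I ^ α * l + aleph I ^ α}

/-- The partition `P_α` of `X` into blocks. -/
def blocks (α : Ordinal.{u}) : Set (Set (Pt I)) :=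
  {Y | ∃ l : Idx I α, Y = block I α l.1}

variable {I}

theorem aleph_ne_zero : aleph I ≠ 0 := by
  have h : (0 : Cardinal.{u}) <
      max Cardinal.aleph0 (max (Cardinal.mk I) (Cardinal.mk (Flag I))) :=
    lt_of_lt_of_le Cardinal.aleph0_pos (le_max_left _ _)
  intro h0
  rw [aleph, Cardinal.ord_eq_zero] at h0
  exact h.ne' h0

theorem pow_ne_zero' (α : Ordinal.{u}) : aleph I ^ α ≠ 0 :=
  (Ordinal.opow_pos α (pos_iff_ne_zero.2 aleph_ne_zero)).ne'

theorem pow_split {α : Ordinal.{u}} (h : α ≤ krullDim I + 1) :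
    aleph I ^ (krullDim I + 1) = aleph I ^ α * aleph I ^ (krullDim I + 1 - α) := by
  rw [← Ordinal.opow_add, Ordinal.add_sub_cancel_of_le h]

theorem mem_block_iff {α l : Ordinal.{u}} {x : Pt I} :
    x ∈ block I α l ↔ x.1 / aleph I ^ α = l := by
  rw [Ordinal.div_eq_iff (pow_ne_zero' α), mul_add, mul_one]
  rfl

/-- Quotient of the (left) division by `ℵ ^ α`. -/
def quo {α : Ordinal.{u}} (h : α ≤ krullDim I + 1) (x : Pt I) : Idx I α :=
  ⟨x.1 / aleph I ^ α, by
    have hx : x.1 < aleph I ^ (krullDim I + 1) * beth I := x.2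
    generalize x.1 = z at hx
    rw [pow_split h, mul_assoc] at hx
    exact (Ordinal.lt_mul_iff_div_lt (pow_ne_zero' α)).1 hx⟩

/-- Remainder of the (left) division by `ℵ ^ α`. -/
def rem (α : Ordinal.{u}) (x : Pt I) : Ordinal.{u} := x.1 % aleph I ^ α

/-- The point `ℵ ^ α * l + r` of `X`. -/
def glue {α : Ordinal.{u}} (h : α ≤ krullDim I + 1) (l : Idx I α)
    (r : Set.Iio (aleph I ^ α)) : Pt I :=
  ⟨aleph I ^ α * l.1 + r.1, by
    rw [Set.mem_Iio, pow_split h, mul_assoc, Ordinal.lt_mul_iff_div_lt (pow_ne_zero' α),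
      Ordinal.mul_add_div _ (pow_ne_zero' α), Ordinal.div_eq_zero_of_lt r.2, add_zero]
    exact l.2⟩

theorem quo_rem_inj {α : Ordinal.{u}} {h : α ≤ krullDim I + 1} {x y : Pt I}
    (hq : quo h x = quo h y) (hr : rem α x = rem α y) : x = y := by
  apply Subtype.ext
  rw [← Ordinal.div_add_mod x.1 (aleph I ^ α), ← Ordinal.div_add_mod y.1 (aleph I ^ α)]
  have := congrArg Subtype.val hq
  simp only [quo] at this
  simp only [rem] at hr
  rw [this, hr]

open Classical in
/-- The ring embedding `φ_α`, with
`φ_α(a)(x, y) = δ(x_r, y_r) a(x_q, y_q)`, where `q` and `r` denote quotients and remainders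
of the division by `ℵ ^ α`. -/
def phi (D : Type v) [Ring D] {α : Ordinal.{u}} (h : α ≤ krullDim I + 1) :
    CFM (Idx I α) D →+ CFM (Pt I) D where
  toFun a := ⟨fun x y => if rem α x = rem α y then a (quo h x) (quo h y) else 0, fun y => by
    refine Set.Finite.of_finite_image (f := quo h)
      ((a.finite_col (quo h y)).subset ?_) ?_
    · rintro _ ⟨x, hx, rfl⟩
      by_contra h0
      simp only [Set.mem_ofPred_eq, not_not] at h0
      exact hx (by rw [h0, ite_self])
    · intro x hx x' hx' hq
      refine quo_rem_inj hq ?_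
      have h1 : rem α x = rem α y := by by_contra h0; exact hx (if_neg h0)
      have h2 : rem α x' = rem α y := by by_contra h0; exact hx' (if_neg h0)
      rw [h1, h2]⟩
  map_zero' := CFM.ext' fun x y => by simp
  map_add' a b := CFM.ext' fun x y => by
    simp only [CFM.add_entry]
    split_ifs <;> simp

/-- `F_α`, the image under `φ_α` of the matrices with finitely many nonzero rows. -/
def F (D : Type v) [Ring D] {α : Ordinal.{u}} (h : α ≤ krullDim I + 1) :
    AddSubgroup (CFM (Pt I) D) :=
  (CFM.finRows (Idx I α) D).map (phi D h)

/-- `G_α`, the image under `φ_α` of the matrices with finitely many nonzero entries. -/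
def G (D : Type v) [Ring D] {α : Ordinal.{u}} (h : α ≤ krullDim I + 1) :
    AddSubgroup (CFM (Pt I) D) :=
  (CFM.finEntries (Idx I α) D).map (phi D h)

/-- The chain `(A' ∩ {≤ i}) ∪ (A ∩ {i ≤})`, for maximal chains `A', A` containing `i`. -/
def swap (i : I) (A' A : {A : Flag I // i ∈ A}) : {A : Flag I // i ∈ A} :=
  ⟨Flag.ofIsMaxChain ({j | j ∈ A'.1 ∧ j ≤ i} ∪ {j | j ∈ A.1 ∧ i ≤ j}) (by
    constructor
    · rintro x (⟨hx, hxi⟩ | ⟨hx, hxi⟩) y (⟨hy, hyi⟩ | ⟨hy, hyi⟩) -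
      · exact A'.1.le_or_le hx hy
      · exact Or.inl (hxi.trans hyi)
      · exact Or.inr (hyi.trans hxi)
      · exact A.1.le_or_le hx hy
    · intro t ht hst
      refine Set.Subset.antisymm hst ?_
      intro x hx
      have hit : i ∈ t := hst (Or.inl ⟨A'.2, le_rfl⟩)
      rcases ht.total hx hit with hxi | hxi
      · refine Or.inl ⟨Flag.mem_iff_forall_le_or_ge.2 fun b hb => ?_, hxi⟩
        rcases A'.1.le_or_le hb A'.2 with hbi | hbi
        · exact ht.total hx (hst (Or.inl ⟨hb, hbi⟩))
        · exact Or.inl (hxi.trans hbi)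
      · refine Or.inr ⟨Flag.mem_iff_forall_le_or_ge.2 fun b hb => ?_, hxi⟩
        rcases A.1.le_or_le hb A.2 with hbi | hbi
        · exact Or.inr (hbi.trans hxi)
        · exact ht.total hx (hst (Or.inr ⟨hb, hbi⟩))),
    Or.inl ⟨A'.2, le_rfl⟩⟩

theorem mem_swap {i : I} {A' A : {A : Flag I // i ∈ A}} {j : I} :
    j ∈ (swap i A' A).1 ↔ (j ∈ A'.1 ∧ j ≤ i) ∨ (j ∈ A.1 ∧ i ≤ j) := Iff.rfl

/-- `A ∼_i B` iff `A` and `B` have the same elements `≤ i`. -/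
def sim (i : I) : Setoid {A : Flag I // i ∈ A} where
  r A B := ∀ j, j ≤ i → (j ∈ A.1 ↔ j ∈ B.1)
  iseqv := ⟨fun _ _ _ => Iff.rfl, fun h j hj => (h j hj).symm,
    fun h h' j hj => (h j hj).trans (h' j hj)⟩

/-- The set of classes of maximal chains through `i` modulo `∼_i`. -/
abbrev Cls (i : I) : Type u := Quotient (sim i)

/-- The map `f_{𝒜' 𝒜}`, given on a maximal chain `A` through `i` by
`(A' ∩ {≤ i}) ∪ (A ∩ {i ≤})` for any `A' ∈ 𝒜'`. -/
def transfer {i : I} (c' : Cls i) (A : {A : Flag I // i ∈ A}) : {A : Flag I // i ∈ A} :=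
  swap i c'.out A

theorem transfer_class {i : I} (c' : Cls i) (A : {A : Flag I // i ∈ A}) :
    (Quotient.mk (sim i) (transfer c' A)) = c' := by
  rw [← Quotient.out_eq c']
  refine Quotient.sound fun j hj => ?_
  rw [Quotient.out_eq, transfer, mem_swap]
  constructor
  · rintro (⟨h, _⟩ | ⟨_, h⟩)
    · exact h
    · rw [le_antisymm hj h]; exact c'.out.2
  · exact fun h => Or.inl ⟨h, hj⟩

theorem transfer_inj {i : I} (c' : Cls i) {A B : {A : Flag I // i ∈ A}}
    (hAB : (Quotient.mk (sim i) A) = Quotient.mk (sim i) B)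
    (h : transfer c' A = transfer c' B) : A = B := by
  have h1 : ∀ j, j ≤ i → (j ∈ A.1 ↔ j ∈ B.1) := Quotient.exact hAB
  have key : ∀ {C E : {A : Flag I // i ∈ A}}, transfer c' C = transfer c' E →
      ∀ j, i ≤ j → j ∈ C.1 → j ∈ E.1 := by
    intro C E hCE j hj hjC
    have h2 : j ∈ (transfer c' E).1 := by
      rw [← hCE]; exact Or.inr ⟨hjC, hj⟩
    rcases mem_swap.1 h2 with ⟨_, h3⟩ | ⟨h3, _⟩
    · rw [le_antisymm h3 hj]; exact E.2
    · exact h3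
  refine Subtype.ext (SetLike.ext fun j => ⟨fun hj => ?_, fun hj => ?_⟩)
  · rcases A.1.le_or_le hj A.2 with h2 | h2
    · exact (h1 j h2).1 hj
    · exact key h j h2 hj
  · rcases B.1.le_or_le hj B.2 with h2 | h2
    · exact (h1 j h2).2 hj
    · exact key h.symm j h2 hj

end Order

section Artinian

variable {I : Type u} [PartialOrder I] [WellFoundedLT I]

/-- The canonical length function `λ(i) = λ_I(i) + 1`, where
`λ_I(i) = sup {λ_I(j) + 1 | j < i}` is the minimum length function. -/
def len (i : I) : Ordinal.{u} := IsWellFounded.rank (fun j k : I => j < k) i + 1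

theorem mem_krullFiltration (α : Ordinal.{u}) (i : I) :
    i ∈ krullFiltration I α ↔ IsWellFounded.rank (fun j k : I => j < k) i < α := by
  induction α using Ordinal.limitRecOn generalizing i with
  | zero => simp [krullFiltration]
  | add_one α ih =>
    rw [krullFiltration, Ordinal.limitRecOn_add_one, ← krullFiltration]
    simp only [Set.mem_union, Set.mem_ofPred_eq, Minimal, ih, not_lt]
    rw [← Order.succ_eq_add_one, Order.lt_succ_iff]
    constructor
    · rintro (h | ⟨h1, h2⟩)
      · exact h.le
      · by_contra h
        rw [not_le] at h
        rw [IsWellFounded.rank_eq] at h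
        obtain ⟨⟨k, hk⟩, hk'⟩ := (Ordinal.lt_iSup_iff).1 h
        have := h2 (Order.lt_succ_iff.1 hk') hk.le
        exact (lt_of_lt_of_le hk this).false
    · intro h
      rcases h.lt_or_eq with h | h
      · exact Or.inl h
      · refine Or.inr ⟨h.ge, fun k hk hki => ?_⟩
        rcases hki.lt_or_eq with h' | h'
        · have := IsWellFounded.rank_lt_of_rel (r := fun j k : I => j < k) h'
          exact absurd (lt_of_lt_of_le (this.trans_eq h) hk) (lt_irrefl _)
        · exact h'.ge
  | limit α hα ih =>
    rw [krullFiltration, Ordinal.limitRecOn_limit _ _ _ _ hα]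
    simp only [Set.mem_iUnion]
    constructor
    · rintro ⟨⟨β, hβ⟩, h⟩
      exact ((ih β hβ i).1 h).trans hβ
    · intro h
      refine ⟨⟨_, hα.succ_lt h⟩, (ih _ (hα.succ_lt h) i).2 (Order.lt_succ _)⟩

theorem rank_lt_krullDim (i : I) :
    IsWellFounded.rank (fun j k : I => j < k) i < krullDim I := by
  have hne : {α : Ordinal.{u} | krullFiltration I (α + 1) = krullFiltration I α}.Nonempty := by
    refine ⟨⨆ j : I, Order.succ (IsWellFounded.rank (fun j k : I => j < k) j), ?_⟩
    have hlt : ∀ j : I, IsWellFounded.rank (fun j k : I => j < k) j <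
        ⨆ j : I, Order.succ (IsWellFounded.rank (fun j k : I => j < k) j) := fun j =>
      lt_of_lt_of_le (Order.lt_succ _) (Ordinal.le_iSup _ j)
    ext j
    simp only [mem_krullFiltration]
    exact ⟨fun _ => hlt j, fun h => h.trans (Order.lt_add_one_iff.2 le_rfl)⟩
  have hmem : krullFiltration I (krullDim I + 1) = krullFiltration I (krullDim I) := csInf_mem hne
  by_contra h
  rw [not_lt] at h
  obtain ⟨j, hj⟩ := IsWellFounded.mem_range_rank_of_le (r := fun j k : I => j < k) h
  have h1 : j ∈ krullFiltration I (krullDim I + 1) := by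
    rw [mem_krullFiltration, hj]; exact Order.lt_add_one_iff.2 le_rfl
  rw [hmem, mem_krullFiltration, hj] at h1
  exact h1.false

theorem len_le (i : I) : len i ≤ krullDim I + 1 :=
  (Order.add_one_le_of_lt (rank_lt_krullDim i)).trans (Order.lt_add_one_iff.2 le_rfl).le

variable (ch : Set.Iio (beth I) ≃ Flag I)

/-- The set of indices `χ < ℶ` such that the maximal chain `A_χ` belongs to the class `c`. -/
def bethOf {i : I} (c : Cls i) : Set (Set.Iio (beth I)) :=
  {χ | ∃ h : i ∈ ch χ, Quotient.mk (sim i) ⟨ch χ, h⟩ = c}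

/-- `X_𝒜`, the union of the blocks `X_χ = X_(ξ+1, χ)` with `A_χ ∈ 𝒜`. -/
def ptsOf {i : I} (c : Cls i) : Set (Pt I) :=
  ⋃ χ ∈ bethOf ch c, block I (krullDim I + 1) χ.1

/-- `X_i`, the union of all `X_𝒜`. -/
def pts (i : I) : Set (Pt I) := ⋃ c : Cls i, ptsOf ch c

/-- `Λ_𝒜`, the set of all `l` such that `X_(λ(i), l) ⊆ X_𝒜`. -/
def Lam {i : I} (c : Cls i) : Set (Idx I (len i)) :=
  {l | block I (len i) l.1 ⊆ ptsOf ch c}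

/-- The bijection `g_{𝒜' 𝒜}` induced on indices by `f_{𝒜' 𝒜}`. -/
def g {i : I} (c c' : Cls i) (χ : bethOf ch c) : bethOf ch c' :=
  ⟨ch.symm (transfer c' ⟨ch χ.1, χ.2.1⟩).1, by
    have h : ch (ch.symm (transfer c' ⟨ch χ.1, χ.2.1⟩).1) = (transfer c' ⟨ch χ.1, χ.2.1⟩).1 :=
      ch.apply_symm_apply _
    refine ⟨by rw [h]; exact (transfer c' ⟨ch χ.1, χ.2.1⟩).2, ?_⟩
    refine Eq.trans ?_ (transfer_class c' ⟨ch χ.1, χ.2.1⟩)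
    congr 1
    exact Subtype.ext h⟩

theorem g_inj {i : I} (c c' : Cls i) : Function.Injective (g ch c c') := by
  intro χ χ' h
  have h1 := ch.symm.injective (congrArg Subtype.val h)
  have h2 := transfer_inj c' (χ.2.2.trans χ'.2.2.symm) (Subtype.ext h1)
  exact Subtype.ext (ch.injective (congrArg Subtype.val h2))

theorem mem_ptsOf_iff {i : I} (c : Cls i) (x : Pt I) :
    x ∈ ptsOf ch c ↔ ∃ χ ∈ bethOf ch c, x.1 / aleph I ^ (krullDim I + 1) = χ.1 := by
  simp only [ptsOf, Set.mem_iUnion, mem_block_iff, exists_prop]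

theorem div_div' (x : Ordinal.{u}) (i : I) :
    x / aleph I ^ (krullDim I + 1) =
      x / aleph I ^ len i / aleph I ^ (krullDim I + 1 - len i) := by
  refine eq_of_forall_gt_iff fun d => ?_
  rw [← Ordinal.lt_mul_iff_div_lt (pow_ne_zero' _), ← Ordinal.lt_mul_iff_div_lt (pow_ne_zero' _),
    ← Ordinal.lt_mul_iff_div_lt (pow_ne_zero' _), pow_split (len_le i), mul_assoc]

theorem mem_Lam_iff {i : I} (c : Cls i) (l : Idx I (len i)) :
    l ∈ Lam ch c ↔
      ∃ χ ∈ bethOf ch c, l.1 / aleph I ^ (krullDim I + 1 - len i) = χ.1 := by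
  constructor
  · intro h
    let x : Pt I := glue (len_le i) l ⟨0, pos_iff_ne_zero.2 (pow_ne_zero' _)⟩
    have hx : x.1 / aleph I ^ len i = l.1 := by
      simp [x, glue, Ordinal.mul_div_cancel _ (pow_ne_zero' (len i))]
    have h1 := (mem_ptsOf_iff ch c x).1 (h (mem_block_iff.2 hx))
    rwa [div_div' _ i, hx] at h1
  · intro h x hx
    rw [mem_ptsOf_iff, div_div' _ i, mem_block_iff.1 hx]
    exact h

theorem quo_mem_Lam {i : I} (c : Cls i) {x : Pt I} (hx : x ∈ ptsOf ch c) :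
    quo (len_le i) x ∈ Lam ch c := by
  rw [mem_Lam_iff]
  rw [mem_ptsOf_iff, div_div' _ i] at hx
  exact hx

/-- The index `χ` of the block of `X` in which `l ∈ Λ_𝒜` lies, i.e. the quotient of `l` by
`ℵ ^ (ξ + 1 - λ(i))`. -/
def chi {i : I} (c : Cls i) (l : Lam ch c) : bethOf ch c :=
  ⟨⟨l.1.1 / aleph I ^ (krullDim I + 1 - len i), by
      obtain ⟨χ, _, h⟩ := (mem_Lam_iff ch c l.1).1 l.2
      rw [h]; exact χ.2⟩, by
    obtain ⟨χ, hχ, h⟩ := (mem_Lam_iff ch c l.1).1 l.2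
    convert hχ⟩

theorem glue_lt {γ b χ σ : Ordinal.{u}} (hχ : χ < b) (hσ : σ < aleph I ^ γ) :
    aleph I ^ γ * χ + σ < aleph I ^ γ * b := by
  rw [Ordinal.lt_mul_iff_div_lt (pow_ne_zero' γ), Ordinal.mul_add_div _ (pow_ne_zero' γ),
    Ordinal.div_eq_zero_of_lt hσ, add_zero]
  exact hχ

/-- The bijection `k_{𝒜' 𝒜}` from `Λ_𝒜` to `Λ_𝒜'`, sending `ℵ ^ (ξ + 1 - λ(i)) * χ + σ` to
`ℵ ^ (ξ + 1 - λ(i)) * g_{𝒜' 𝒜}(χ) + σ`. -/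
def kk {i : I} (c c' : Cls i) (l : Lam ch c) : Lam ch c' :=
  ⟨⟨aleph I ^ (krullDim I + 1 - len i) * (g ch c c' (chi ch c l)).1.1 +
      l.1.1 % aleph I ^ (krullDim I + 1 - len i),
      glue_lt (g ch c c' (chi ch c l)).1.2 (Ordinal.mod_lt _ (pow_ne_zero' _))⟩, by
    rw [mem_Lam_iff]
    refine ⟨(g ch c c' (chi ch c l)).1, (g ch c c' (chi ch c l)).2, ?_⟩
    rw [Ordinal.mul_add_div _ (pow_ne_zero' _),
      Ordinal.div_eq_zero_of_lt (Ordinal.mod_lt _ (pow_ne_zero' _)), add_zero]⟩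

theorem kk_inj {i : I} (c c' : Cls i) : Function.Injective (kk ch c c') := by
  intro l l' h
  have h0 : (kk ch c c' l).1.1 = (kk ch c c' l').1.1 := by rw [h]
  simp only [kk] at h0
  have hdiv := congrArg (· / aleph I ^ (krullDim I + 1 - len i)) h0
  have hmod := congrArg (· % aleph I ^ (krullDim I + 1 - len i)) h0
  simp only [Ordinal.mul_add_div _ (pow_ne_zero' _),
    Ordinal.div_eq_zero_of_lt (Ordinal.mod_lt _ (pow_ne_zero' _)), add_zero] at hdiv
  simp only [Ordinal.mul_add_mod_self, Ordinal.mod_mod] at hmod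
  have h1 : chi ch c l = chi ch c l' :=
    g_inj ch c c' (Subtype.ext (Subtype.ext hdiv))
  have h2 : l.1.1 / aleph I ^ (krullDim I + 1 - len i) =
      l'.1.1 / aleph I ^ (krullDim I + 1 - len i) :=
    congrArg (fun z => z.1.1) h1
  refine Subtype.ext (Subtype.ext ?_)
  rw [← Ordinal.div_add_mod l.1.1 (aleph I ^ (krullDim I + 1 - len i)),
    ← Ordinal.div_add_mod l'.1.1 (aleph I ^ (krullDim I + 1 - len i)), h2, hmod]

end Artinian

/-- The data on which the construction depends: a bijection `χ ↦ A_χ` from `ℶ` to the set of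
maximal chains, and for every `i` a class `𝒜_i` of maximal chains through `i` together with a
bijection from `Λ_{𝒜_i}` to `ℵ ^ (ξ + 1 - λ(i)) * ℶ`. -/
structure Choice (I : Type u) [PartialOrder I] [WellFoundedLT I] where
  chain : Set.Iio (beth I) ≃ Flag I
  base : ∀ i : I, Cls i
  bij : ∀ i : I, Lam chain (base i) ≃ Idx I (len i)

section Rings

variable {I : Type u} [PartialOrder I] [WellFoundedLT I] (K : Choice I)

/-- The bijection `k_𝒜 = k_{𝒜_i} ∘ k_{𝒜_i 𝒜}`. -/
def kMap {i : I} (c : Cls i) (l : Lam K.chain c) : Idx I (len i) :=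
  K.bij i (kk K.chain c (K.base i) l)

/-- The bijection `t_𝒜 : X_𝒜 → X`, sending `ℵ ^ λ(i) * l + r` to `ℵ ^ λ(i) * k_𝒜(l) + r`. -/
def tMap {i : I} (c : Cls i) (x : ptsOf K.chain c) : Pt I :=
  glue (len_le i) (kMap K c ⟨quo (len_le i) x.1, quo_mem_Lam K.chain c x.2⟩)
    ⟨rem (len i) x.1, Ordinal.mod_lt _ (pow_ne_zero' _)⟩

theorem tMap_inj {i : I} (c : Cls i) : Function.Injective (tMap K c) := by
  intro x y h
  have h0 := congrArg Subtype.val h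
  simp only [tMap, glue] at h0
  have hdiv := congrArg (· / aleph I ^ len i) h0
  have hmod := congrArg (· % aleph I ^ len i) h0
  simp only [Ordinal.mul_add_div _ (pow_ne_zero' _), rem,
    Ordinal.div_eq_zero_of_lt (Ordinal.mod_lt _ (pow_ne_zero' _)), add_zero] at hdiv
  simp only [rem, Ordinal.mul_add_mod_self, Ordinal.mod_mod] at hmod
  have h1 := kk_inj K.chain c (K.base i) ((K.bij i).injective (Subtype.ext hdiv))
  exact Subtype.ext (quo_rem_inj (h := len_le i) (congrArg Subtype.val h1) hmod)

theorem class_unique (ch : Set.Iio (beth I) ≃ Flag I) {i : I} {c c' : Cls i} {x : Pt I}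
    (h : x ∈ ptsOf ch c) (h' : x ∈ ptsOf ch c') : c = c' := by
  obtain ⟨χ, ⟨h1, h2⟩, h3⟩ := (mem_ptsOf_iff ch c x).1 h
  obtain ⟨χ', ⟨h1', h2'⟩, h3'⟩ := (mem_ptsOf_iff ch c' x).1 h'
  have : χ = χ' := Subtype.ext (h3.symm.trans h3')
  subst this
  exact h2.symm.trans h2'

open Classical in
/-- The entries of `ψ_i(a)`: `a(t_𝒜(x), t_𝒜(y))` if `x, y ∈ X_𝒜` for some (necessarily unique)
class `𝒜`, and `0` otherwise. -/
def psiEntry {D : Type v} [Ring D] (i : I) (a : CFM (Pt I) D) (x y : Pt I) : D :=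
  if h : ∃ c : Cls i, x ∈ ptsOf K.chain c ∧ y ∈ ptsOf K.chain c then
    a (tMap K h.choose ⟨x, h.choose_spec.1⟩) (tMap K h.choose ⟨y, h.choose_spec.2⟩)
  else 0

theorem psiEntry_of_mem {D : Type v} [Ring D] {i : I} (a : CFM (Pt I) D) {x y : Pt I}
    {c : Cls i} (hx : x ∈ ptsOf K.chain c) (hy : y ∈ ptsOf K.chain c) :
    psiEntry K i a x y = a (tMap K c ⟨x, hx⟩) (tMap K c ⟨y, hy⟩) := by
  have h : ∃ c : Cls i, x ∈ ptsOf K.chain c ∧ y ∈ ptsOf K.chain c := ⟨c, hx, hy⟩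
  obtain rfl : h.choose = c := class_unique K.chain h.choose_spec.1 hx
  rw [psiEntry, dif_pos h]

theorem psiEntry_of_not {D : Type v} [Ring D] {i : I} (a : CFM (Pt I) D) {x y : Pt I}
    (h : ¬∃ c : Cls i, x ∈ ptsOf K.chain c ∧ y ∈ ptsOf K.chain c) :
    psiEntry K i a x y = 0 := dif_neg h

/-- The embedding `ψ_i : Q → Q`, where `Q` is the ring of column-finite `X × X` matrices. -/
def psi (D : Type v) [Ring D] (i : I) : CFM (Pt I) D →+ CFM (Pt I) D where
  toFun a := ⟨psiEntry K i a, fun y => by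
    by_cases hy : ∃ c : Cls i, y ∈ ptsOf K.chain c
    · obtain ⟨c, hy⟩ := hy
      have hsub : {x | psiEntry K i a x y ≠ 0} ⊆
          Subtype.val '' ((tMap K c) ⁻¹' {u | a u (tMap K c ⟨y, hy⟩) ≠ 0}) := by
        intro x hx
        have h : ∃ c : Cls i, x ∈ ptsOf K.chain c ∧ y ∈ ptsOf K.chain c := by
          by_contra h
          exact hx (psiEntry_of_not K a h)
        obtain ⟨c', hx', hy'⟩ := h
        obtain rfl := class_unique K.chain hy' hy
        refine ⟨⟨x, hx'⟩, ?_, rfl⟩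
        rwa [Set.mem_ofPred_eq, psiEntry_of_mem K a hx' hy'] at hx
      exact (((a.finite_col _).preimage (tMap_inj K c).injOn).image _).subset hsub
    · refine Set.finite_empty.subset fun x hx => hx (psiEntry_of_not K a ?_)
      rintro ⟨c, _, hc⟩
      exact hy ⟨c, hc⟩⟩
  map_zero' := CFM.ext' fun x y => by
    change psiEntry K i 0 x y = 0
    unfold psiEntry
    split_ifs <;> simp
  map_add' a b := CFM.ext' fun x y => by
    change psiEntry K i (a + b) x y = psiEntry K i a x y + psiEntry K i b x y
    unfold psiEntry
    split_ifs <;> simp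

open Classical in
/-- The additive group `H_i` attached to the element `i` of the polarized poset `(I, I')`. -/
def H (I' : LowerSet I) (D : Type v) [Ring D] (i : I) : AddSubgroup (CFM (Pt I) D) :=
  if IsMax i then (CFM.scalar (Pt I) D).toAddMonoidHom.range.map (psi K D i)
  else if i ∈ I' then (F D (len_le i)).map (psi K D i)
  else (G D (len_le i)).map (psi K D i)

/-- `Y(i)`, the union of the preimages of `Y` under all `t_𝒜`, where `𝒜` ranges over the classes
of maximal chains through `i`. -/
def spread (i : I) (Y : Set (Pt I)) : Set (Pt I) :=
  ⋃ c : Cls i, Subtype.val '' ((tMap K c) ⁻¹' Y)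

end Rings

end PosetRing

end

/-! Fix `i`. A point `x` of `X_i` consists of its maximal chain and its digits in base `ℵ`. Cut both
at `i`. The part of the chain below `i` and the digits below `λ(i)` form the low part; the part of
the chain above `i` and the remaining digits (`middle i x`) are encoded by `content K i x`. The two
coordinates are independent: low part and content determine `x`, and every content occurs with every
low part. So `X_i` is a product (low classes) × (contents), and `embed K D i m` is `1 ⊗ m` on it,
extended by zero. Hence `embed` is injective and multiplicative, sends `1` to `e_{X_i}`, and `H_i`
is the image of scalars, finite-row matrices or finite matrices.

If `i ≤ j`, passing from `i` to `j` only moves data from the content into the low part. Therefore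
each element of `H_j` preserves `X_i` and acts there as `1 ⊗ r` (`embed_mem_invariants`), so
multiplying `H_i` by it amounts to multiplying by `r` (`embed_mul`, `mul_embed`). For non-maximal
`i` the ideal properties of finite-row and finite matrices give `H_i a ⊆ H_i` and `a H_i ⊆ H_i`; the
only extra need, row-finiteness when `i ∉ I'`, holds because `I'` is a lower set.

Independence and nonvanishing both rest on `exists_sum_entry_ne_zero`. In a finite sum pick `j`
maximal in the support. A nonzero entry of the `j`-th term repeats along infinitely many rows with
the same chain and the same content at `j`, but with distinct contents at every `k < j` of the
chain. Each other term is nonzero in only finitely many of these rows, so in some row the `j`-th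
term stands alone. -/

noncomputable section

universe u v w

namespace PosetRing

/-! ### Iterated division of ordinals. -/

section OrdinalArithmetic

theorem ordinal_div_div (x : Ordinal.{u}) {a b : Ordinal.{u}} (ha : a ≠ 0) (hb : b ≠ 0) :
    x / a / b = x / (a * b) := by
  refine eq_of_forall_gt_iff fun d => ?_
  rw [← Ordinal.lt_mul_iff_div_lt hb, ← Ordinal.lt_mul_iff_div_lt ha,
    ← Ordinal.lt_mul_iff_div_lt (mul_ne_zero ha hb), mul_assoc]

/-- Dividing by `a` and then by `b` leaves two remainders; read as digits, they make an ordinal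
already below `a * b`. -/
theorem ordinal_mod_mul (x : Ordinal.{u}) {a b : Ordinal.{u}} (ha : a ≠ 0) (hb : b ≠ 0) :
    x % (a * b) = a * (x / a % b) + x % a := by
  have hx : x = a * b * (x / a / b) + (a * (x / a % b) + x % a) := by
    rw [← add_assoc, mul_assoc, ← mul_add, Ordinal.div_add_mod, Ordinal.div_add_mod]
  conv_lhs => rw [hx]
  rw [Ordinal.mul_add_mod_self, Ordinal.mod_eq_of_lt]
  rw [Ordinal.lt_mul_iff_div_lt ha, Ordinal.mul_add_div _ ha,
    Ordinal.div_eq_zero_of_lt (Ordinal.mod_lt _ ha), add_zero]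
  exact Ordinal.mod_lt _ hb

theorem ordinal_mod_mul_div (x : Ordinal.{u}) {b c : Ordinal.{u}} (hb : b ≠ 0) (hc : c ≠ 0) :
    x % (b * c) / b = x / b % c := by
  rw [ordinal_mod_mul x hb hc, Ordinal.mul_add_div _ hb,
    Ordinal.div_eq_zero_of_lt (Ordinal.mod_lt _ hb), add_zero]

end OrdinalArithmetic

/-! ### Low part and content of a point. -/

section Coordinates

variable {I : Type u} [PartialOrder I]

theorem natCast_lt_aleph (n : ℕ) : (n : Ordinal.{u}) < aleph I :=
  (Ordinal.natCast_lt_omega0 n).trans_le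
    (by rw [← Cardinal.ord_aleph0]; exact Cardinal.ord_le_ord.2 (le_max_left _ _))

theorem transfer_eq_transfer_iff {i : I} (c : Cls i) {A B : {A : Flag I // i ∈ A}} :
    transfer c A = transfer c B ↔ ∀ j, i ≤ j → (j ∈ A.1 ↔ j ∈ B.1) := by
  constructor
  · have key : ∀ {A B : {A : Flag I // i ∈ A}}, transfer c A = transfer c B →
        ∀ j, i ≤ j → j ∈ A.1 → j ∈ B.1 := by
      intro A B h j hj hA
      have h1 : j ∈ (transfer c B).1 := by
        rw [← h]; exact Or.inr ⟨hA, hj⟩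
      rcases mem_swap.1 h1 with ⟨_, h2⟩ | ⟨h2, _⟩
      · rw [le_antisymm h2 hj]; exact B.2
      · exact h2
    exact fun h j hj => ⟨key h j hj, key h.symm j hj⟩
  · intro h
    refine Subtype.ext (SetLike.ext fun j => ?_)
    rw [transfer, transfer, mem_swap, mem_swap]
    refine or_congr_right ⟨fun h' => ⟨(h j h'.2).1 h'.1, h'.2⟩, fun h' => ⟨(h j h'.2).2 h'.1, h'.2⟩⟩

/-- A transfer keeps the part of the chain above `i`, and the class `c` restores the part below. -/
theorem transfer_transfer {i : I} (c c' : Cls i) (A : {A : Flag I // i ∈ A})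
    (hA : Quotient.mk (sim i) A = c) : transfer c (transfer c' A) = A := by
  refine transfer_inj c' ?_ ?_
  · rw [transfer_class, hA]
  · rw [transfer_eq_transfer_iff]
    intro j hj
    rw [transfer, transfer, mem_swap, mem_swap]
    constructor
    · rintro (⟨_, h⟩ | ⟨⟨_, h⟩ | ⟨h, _⟩, _⟩)
      · rw [le_antisymm h hj]; exact A.2
      · rw [le_antisymm h hj]; exact A.2
      · exact h
    · exact fun h => Or.inr ⟨Or.inr ⟨h, hj⟩, hj⟩

theorem g_g {ch : Set.Iio (beth I) ≃ Flag I} {i : I} (c c' : Cls i) (χ : bethOf ch c) :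
    g ch c' c (g ch c c' χ) = χ := by
  have h1 : (⟨ch (g ch c c' χ).1, (g ch c c' χ).2.1⟩ : {A : Flag I // i ∈ A}) =
      transfer c' ⟨ch χ.1, χ.2.1⟩ := Subtype.ext (ch.apply_symm_apply _)
  refine Subtype.ext ?_
  rw [g, ← ch.injective.eq_iff, ch.apply_symm_apply, h1, transfer_transfer _ _ _ χ.2.2]

variable [WellFoundedLT I]

theorem len_lt_len {i j : I} (h : i < j) : len i < len j := by
  have := IsWellFounded.rank_lt_of_rel (r := fun j k : I => j < k) h
  simpa [len] using this

theorem len_mono {i j : I} (h : i ≤ j) : len i ≤ len j := by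
  rcases h.eq_or_lt with rfl | h
  · exact le_rfl
  · exact (len_lt_len h).le

/-- The part of `x` between the remainder modulo `ℵ ^ λ(i)` and the quotient by `ℵ ^ (ξ + 1)`. -/
def middle (i : I) (x : Pt I) : Ordinal.{u} :=
  x.1 / aleph I ^ len i % aleph I ^ (krullDim I + 1 - len i)

theorem pow_len_split {i j : I} (h : i ≤ j) :
    aleph I ^ len j = aleph I ^ len i * aleph I ^ (len j - len i) := by
  rw [← Ordinal.opow_add, Ordinal.add_sub_cancel_of_le (len_mono h)]

theorem pow_colen_split {i j : I} (h : i ≤ j) :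
    aleph I ^ (krullDim I + 1 - len i) =
      aleph I ^ (len j - len i) * aleph I ^ (krullDim I + 1 - len j) := by
  rw [← Ordinal.opow_add]
  congr 1
  refine (add_right_inj (len i)).1 ?_
  rw [← add_assoc, Ordinal.add_sub_cancel_of_le (len_mono h),
    Ordinal.add_sub_cancel_of_le (len_le j), Ordinal.add_sub_cancel_of_le (len_le i)]

theorem rem_len_of_le {i j : I} (h : i ≤ j) (x : Pt I) :
    rem (len j) x % aleph I ^ len i = rem (len i) x := by
  rw [rem, rem, pow_len_split h, Ordinal.mod_mod_of_dvd _ (dvd_mul_right _ _)]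

/-- With `middle_of_le` this describes the passage from `i` to `j`: the low digits of `middle i x`
join the remainder, and only the higher ones stay in `middle j x`. -/
theorem rem_len_eq {i j : I} (h : i ≤ j) (x : Pt I) :
    rem (len j) x =
      aleph I ^ len i * (middle i x % aleph I ^ (len j - len i)) + rem (len i) x := by
  rw [rem, rem, middle, pow_len_split h, ordinal_mod_mul _ (pow_ne_zero' _) (pow_ne_zero' _),
    pow_colen_split h, Ordinal.mod_mod_of_dvd _ (dvd_mul_right _ _)]

theorem middle_of_le {i j : I} (h : i ≤ j) (x : Pt I) :
    middle j x = middle i x / aleph I ^ (len j - len i) := by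
  rw [middle, middle, pow_colen_split h, ordinal_mod_mul_div _ (pow_ne_zero' _) (pow_ne_zero' _),
    ordinal_div_div _ (pow_ne_zero' _) (pow_ne_zero' _), ← pow_len_split h]

variable (K : Choice I)

/-- The maximal chain `A_χ` with `x ∈ X_(ξ+1, χ)`. -/
def flagOf (x : Pt I) : Flag I :=
  K.chain ⟨x.1 / aleph I ^ (krullDim I + 1),
    (Ordinal.lt_mul_iff_div_lt (pow_ne_zero' _)).1 x.2⟩

theorem flagOf_eq_iff {x y : Pt I} : flagOf K x = flagOf K y ↔
    x.1 / aleph I ^ (krullDim I + 1) = y.1 / aleph I ^ (krullDim I + 1) := by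
  exact K.chain.injective.eq_iff.trans Subtype.ext_iff

theorem exists_flagOf_eq (A : Flag I) : ∃ x : Pt I, flagOf K x = A := by
  refine ⟨⟨aleph I ^ (krullDim I + 1) * (K.chain.symm A).1, ?_⟩, ?_⟩
  · simpa using glue_lt (I := I) (γ := krullDim I + 1) (K.chain.symm A).2
      (pos_iff_ne_zero.2 (pow_ne_zero' _))
  · rw [flagOf, ← Equiv.eq_symm_apply]
    exact Subtype.ext (Ordinal.mul_div_cancel _ (pow_ne_zero' _))

/-- The class modulo `∼_i` of the maximal chain of a point of `X_i`. -/
def clsOf {i : I} {x : Pt I} (h : i ∈ flagOf K x) : Cls i := Quotient.mk (sim i) ⟨flagOf K x, h⟩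

theorem mem_ptsOf_iff_clsOf {i : I} {c : Cls i} {x : Pt I} :
    x ∈ ptsOf K.chain c ↔ ∃ h : i ∈ flagOf K x, clsOf K h = c := by
  rw [mem_ptsOf_iff]
  constructor
  · rintro ⟨χ, hχ, hx⟩
    obtain rfl : (⟨_, (Ordinal.lt_mul_iff_div_lt (pow_ne_zero' _)).1 x.2⟩ : Set.Iio (beth I)) = χ :=
      Subtype.ext hx
    exact hχ
  · exact fun h => ⟨_, h, rfl⟩

theorem mem_ptsOf_clsOf {i : I} {x : Pt I} (h : i ∈ flagOf K x) :
    x ∈ ptsOf K.chain (clsOf K h) := (mem_ptsOf_iff_clsOf K).2 ⟨h, rfl⟩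

theorem mem_pts_iff {i : I} {x : Pt I} : x ∈ pts K.chain i ↔ i ∈ flagOf K x := by
  simp only [pts, Set.mem_iUnion, mem_ptsOf_iff_clsOf]
  exact ⟨fun ⟨_, h, _⟩ => h, fun h => ⟨_, h, rfl⟩⟩

theorem clsOf_eq_iff {i : I} {x y : Pt I} (hx : i ∈ flagOf K x) (hy : i ∈ flagOf K y) :
    clsOf K hx = clsOf K hy ↔ ∀ j, j ≤ i → (j ∈ flagOf K x ↔ j ∈ flagOf K y) :=
  Quotient.eq (r := sim i)

/-- Two points of `X_i` lie in the same `X_𝒜` and have the same remainder modulo `ℵ ^ λ(i)`. -/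
def Low (i : I) (x y : Pt I) : Prop :=
  i ∈ flagOf K x ∧ i ∈ flagOf K y ∧ (∀ j, j ≤ i → (j ∈ flagOf K x ↔ j ∈ flagOf K y)) ∧
    rem (len i) x = rem (len i) y

variable {K}

theorem Low.refl {i : I} {x : Pt I} (h : i ∈ flagOf K x) : Low K i x x :=
  ⟨h, h, fun _ _ => Iff.rfl, rfl⟩

theorem Low.symm {i : I} {x y : Pt I} (h : Low K i x y) : Low K i y x :=
  ⟨h.2.1, h.1, fun j hj => (h.2.2.1 j hj).symm, h.2.2.2.symm⟩

theorem Low.trans {i : I} {x y z : Pt I} (h : Low K i x y) (h' : Low K i y z) : Low K i x z :=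
  ⟨h.1, h'.2.1, fun j hj => (h.2.2.1 j hj).trans (h'.2.2.1 j hj), h.2.2.2.trans h'.2.2.2⟩

theorem Low.of_le {i j : I} (hij : i ≤ j) {x y : Pt I} (h : Low K j x y)
    (hx : i ∈ flagOf K x) : Low K i x y :=
  ⟨hx, (h.2.2.1 i hij).1 hx, fun k hk => h.2.2.1 k (hk.trans hij), by
    rw [← rem_len_of_le hij, h.2.2.2, rem_len_of_le hij]⟩

variable (K)

open Classical in
/-- The index in `ℵ ^ (ξ + 1 - λ(i)) * ℶ` of the block of `ℵ ^ λ(i)` points which contains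
`t_𝒜(x)`, for `x ∈ X_𝒜`; a junk value outside `X_i`. -/
def content (i : I) (x : Pt I) : Idx I (len i) :=
  if h : i ∈ flagOf K x then
    kMap K (clsOf K h) ⟨quo (len_le i) x, quo_mem_Lam K.chain _ (mem_ptsOf_clsOf K h)⟩
  else quo (len_le i) x

theorem content_of_mem {i : I} {c : Cls i} {x : Pt I} (h : x ∈ ptsOf K.chain c) :
    content K i x = kMap K c ⟨quo (len_le i) x, quo_mem_Lam K.chain c h⟩ := by
  obtain ⟨hx, rfl⟩ := (mem_ptsOf_iff_clsOf K).1 h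
  rw [content, dif_pos hx]

theorem quo_tMap {i : I} {c : Cls i} {x : Pt I} (h : x ∈ ptsOf K.chain c) :
    quo (len_le i) (tMap K c ⟨x, h⟩) = content K i x := by
  rw [content_of_mem K h]
  refine Subtype.ext ?_
  simp only [quo, tMap, glue, rem]
  rw [Ordinal.mul_add_div _ (pow_ne_zero' _),
    Ordinal.div_eq_zero_of_lt (Ordinal.mod_lt _ (pow_ne_zero' _)), add_zero]

theorem rem_tMap {i : I} {c : Cls i} {x : Pt I} (h : x ∈ ptsOf K.chain c) :
    rem (len i) (tMap K c ⟨x, h⟩) = rem (len i) x := by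
  simp only [tMap, glue, rem]
  rw [Ordinal.mul_add_mod_self, Ordinal.mod_mod]

theorem kk_val {ch : Set.Iio (beth I) ≃ Flag I} {i : I} (c c' : Cls i) (l : Lam ch c) :
    (kk ch c c' l).1.1 = aleph I ^ (krullDim I + 1 - len i) * (g ch c c' (chi ch c l)).1.1 +
      l.1.1 % aleph I ^ (krullDim I + 1 - len i) := rfl

theorem kk_div {ch : Set.Iio (beth I) ≃ Flag I} {i : I} (c c' : Cls i) (l : Lam ch c) :
    (kk ch c c' l).1.1 / aleph I ^ (krullDim I + 1 - len i) = (g ch c c' (chi ch c l)).1.1 := by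
  rw [kk_val, Ordinal.mul_add_div _ (pow_ne_zero' _),
    Ordinal.div_eq_zero_of_lt (Ordinal.mod_lt _ (pow_ne_zero' _)), add_zero]

theorem kk_mod {ch : Set.Iio (beth I) ≃ Flag I} {i : I} (c c' : Cls i) (l : Lam ch c) :
    (kk ch c c' l).1.1 % aleph I ^ (krullDim I + 1 - len i) =
      l.1.1 % aleph I ^ (krullDim I + 1 - len i) := by
  rw [kk_val, Ordinal.mul_add_mod_self, Ordinal.mod_mod]

theorem kk_kk {ch : Set.Iio (beth I) ≃ Flag I} {i : I} (c c' : Cls i) (l : Lam ch c) :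
    kk ch c' c (kk ch c c' l) = l := by
  refine Subtype.ext (Subtype.ext ?_)
  have h1 : chi ch c' (kk ch c c' l) = g ch c c' (chi ch c l) :=
    Subtype.ext (Subtype.ext (kk_div c c' l))
  rw [kk_val, h1, g_g, kk_mod]
  exact Ordinal.div_add_mod _ _

theorem kMap_surjective {i : I} (c : Cls i) : Function.Surjective (kMap K c) := fun p =>
  ⟨kk K.chain (K.base i) c ((K.bij i).symm p), by rw [kMap, kk_kk, Equiv.apply_symm_apply]⟩

/-- Since `K.bij i` is injective, the content amounts to the value of `kk`. Its remainder is `middle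
i x`; its quotient indexes the chain transferred to the base class, which remembers exactly the part
above `i`. -/
theorem content_eq_iff {i : I} {x y : Pt I} (hx : i ∈ flagOf K x) (hy : i ∈ flagOf K y) :
    content K i x = content K i y ↔
      (∀ j, i ≤ j → (j ∈ flagOf K x ↔ j ∈ flagOf K y)) ∧ middle i x = middle i y := by
  -- The index used by `kk` is the quotient by `ℵ ^ (ξ + 1)` taken in two stages, so it names the
  -- chain of `z`.
  have hA : ∀ {z : Pt I} (hz : i ∈ flagOf K z),
      (⟨K.chain (chi K.chain (clsOf K hz) ⟨quo (len_le i) z,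
        quo_mem_Lam K.chain _ (mem_ptsOf_clsOf K hz)⟩).1, (chi K.chain (clsOf K hz) _).2.1⟩ :
        {A : Flag I // i ∈ A}) = ⟨flagOf K z, hz⟩ := by
    intro z hz
    refine Subtype.ext (congrArg K.chain (Subtype.ext ?_))
    exact (div_div' z.1 i).symm
  rw [content_of_mem K (mem_ptsOf_clsOf K hx), content_of_mem K (mem_ptsOf_clsOf K hy), kMap, kMap,
    (K.bij i).injective.eq_iff, ← transfer_eq_transfer_iff (K.base i)
      (A := ⟨flagOf K x, hx⟩) (B := ⟨flagOf K y, hy⟩), ← hA hx, ← hA hy]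
  constructor
  · intro h
    have h0 := congrArg (fun z => z.1.1) h
    refine ⟨?_, ?_⟩
    · have h1 := congrArg (· / aleph I ^ (krullDim I + 1 - len i)) h0
      simp only [kk_div] at h1
      exact Subtype.ext (K.chain.symm.injective (Subtype.ext h1))
    · have h1 := congrArg (· % aleph I ^ (krullDim I + 1 - len i)) h0
      simp only [kk_mod] at h1
      exact h1
  · rintro ⟨h1, h2⟩
    refine Subtype.ext (Subtype.ext ?_)
    exact congrArg₂ (fun a b => aleph I ^ (krullDim I + 1 - len i) * a + b)
      (congrArg (fun A : {A : Flag I // i ∈ A} => (K.chain.symm A.1).1) h1) h2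

/-- Keep the remainder of `x` and replace its quotient by a preimage of `p` under `kMap`; membership
of that preimage in `Λ_𝒜` keeps the new point in `X_𝒜`. -/
theorem exists_low_content_eq {i : I} {x : Pt I} (hx : i ∈ flagOf K x) (p : Idx I (len i)) :
    ∃ y, Low K i x y ∧ content K i y = p := by
  obtain ⟨l, rfl⟩ := kMap_surjective K (clsOf K hx) p
  let y : Pt I := glue (len_le i) l.1 ⟨rem (len i) x, Ordinal.mod_lt _ (pow_ne_zero' _)⟩
  have hq : quo (len_le i) y = l.1 := Subtype.ext (by
    simp only [quo, y, glue, rem]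
    rw [Ordinal.mul_add_div _ (pow_ne_zero' _),
      Ordinal.div_eq_zero_of_lt (Ordinal.mod_lt _ (pow_ne_zero' _)), add_zero])
  have hr : rem (len i) y = rem (len i) x := by
    simp only [y, glue, rem]
    rw [Ordinal.mul_add_mod_self, Ordinal.mod_mod]
  have hy : y ∈ ptsOf K.chain (clsOf K hx) := by
    refine l.2 (mem_block_iff.2 ?_)
    rw [← hq]; rfl
  refine ⟨y, ?_, ?_⟩
  · obtain ⟨hy1, hy2⟩ := (mem_ptsOf_iff_clsOf K).1 hy
    exact ⟨hx, hy1, (clsOf_eq_iff K hx hy1).1 hy2.symm, hr.symm⟩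
  · rw [content_of_mem K hy]
    congr 1
    exact Subtype.ext hq

variable {K}

theorem Low.clsOf_eq {i : I} {x y : Pt I} (h : Low K i x y) : clsOf K h.1 = clsOf K h.2.1 :=
  (clsOf_eq_iff K h.1 h.2.1).2 h.2.2.1

theorem Low.mem_ptsOf {i : I} {x y : Pt I} (h : Low K i x y) :
    y ∈ ptsOf K.chain (clsOf K h.1) := (mem_ptsOf_iff_clsOf K).2 ⟨h.2.1, h.clsOf_eq.symm⟩

/-- The chains agree below `i` by `Low` and above `i` by content, hence everywhere; then all digits
agree as well. -/
theorem Low.eq_of_content_eq {i : I} {x y : Pt I} (h : Low K i x y)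
    (hc : content K i x = content K i y) : x = y := by
  rw [content_eq_iff K h.1 h.2.1] at hc
  have hf : flagOf K x = flagOf K y := by
    refine SetLike.ext fun j => ⟨fun hj => ?_, fun hj => ?_⟩
    · rcases (flagOf K x).le_or_le hj h.1 with h' | h'
      · exact (h.2.2.1 j h').1 hj
      · exact (hc.1 j h').1 hj
    · rcases (flagOf K y).le_or_le hj h.2.1 with h' | h'
      · exact (h.2.2.1 j h').2 hj
      · exact (hc.1 j h').2 hj
  refine quo_rem_inj (h := len_le i) (Subtype.ext ?_) h.2.2.2
  change x.1 / aleph I ^ len i = y.1 / aleph I ^ len i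
  rw [flagOf_eq_iff, div_div' _ i, div_div' _ i] at hf
  have hm := hc.2
  simp only [middle] at hm
  rw [← Ordinal.div_add_mod (x.1 / aleph I ^ len i) (aleph I ^ (krullDim I + 1 - len i)), hf, hm,
    Ordinal.div_add_mod]

theorem mem_flagOf_of_content_eq {i j : I} (hij : i ≤ j) {x y : Pt I} (hx : i ∈ flagOf K x)
    (hy : i ∈ flagOf K y) (h : content K i x = content K i y) (hj : j ∈ flagOf K x) :
    j ∈ flagOf K y := (((content_eq_iff K hx hy).1 h).1 j hij).1 hj

theorem content_eq_of_le {i j : I} (hij : i ≤ j) {x y : Pt I} (hx : i ∈ flagOf K x)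
    (hy : i ∈ flagOf K y) (h : content K i x = content K i y) (hj : j ∈ flagOf K x) :
    content K j x = content K j y := by
  have hj' := mem_flagOf_of_content_eq hij hx hy h hj
  rw [content_eq_iff K hx hy] at h
  rw [content_eq_iff K hj hj']
  exact ⟨fun k hk => h.1 k (hij.trans hk), by rw [middle_of_le hij, middle_of_le hij, h.2]⟩

/-- The low part at `j` is a function of the low part and the content at `i`, so whether two points
with a common low part at `i` are `Low` at `j` depends only on their contents at `i`. -/
theorem Low.of_content_eq {i j : I} (hij : i ≤ j) {x y x' y' : Pt I} (hx : i ∈ flagOf K x)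
    (hy : i ∈ flagOf K y) (hxy : Low K i x' y') (hcx : content K i x = content K i x')
    (hcy : content K i y = content K i y') (h : Low K j x y) : Low K j x' y' := by
  refine ⟨mem_flagOf_of_content_eq hij hx hxy.1 hcx h.1,
    mem_flagOf_of_content_eq hij hy hxy.2.1 hcy h.2.1, ?_, ?_⟩
  · rw [content_eq_iff K hx hxy.1] at hcx
    rw [content_eq_iff K hy hxy.2.1] at hcy
    intro k hk
    have key : i ≤ k → (k ∈ flagOf K x' ↔ k ∈ flagOf K y') := fun hik =>
      (hcx.1 k hik).symm.trans ((h.2.2.1 k hk).trans (hcy.1 k hik))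
    constructor <;> intro hk'
    · rcases (flagOf K x').le_or_le hk' hxy.1 with h' | h'
      · exact (hxy.2.2.1 k h').1 hk'
      · exact (key h').1 hk'
    · rcases (flagOf K y').le_or_le hk' hxy.2.1 with h' | h'
      · exact (hxy.2.2.1 k h').2 hk'
      · exact (key h').2 hk'
  · have h1 := h.2.2.2
    have h2 : middle i x % aleph I ^ (len j - len i) = middle i y % aleph I ^ (len j - len i) := by
      rw [rem_len_eq hij, rem_len_eq hij, h.of_le hij hx |>.2.2.2] at h1
      have := congrArg (· / aleph I ^ len i) h1
      simpa only [Ordinal.mul_add_div _ (pow_ne_zero' (len i)), rem,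
        Ordinal.div_eq_zero_of_lt (Ordinal.mod_lt _ (pow_ne_zero' _)), add_zero] using this
    rw [rem_len_eq hij, rem_len_eq hij, hxy.2.2.2, ← ((content_eq_iff K hx hxy.1).1 hcx).2,
      ← ((content_eq_iff K hy hxy.2.1).1 hcy).2, h2]

/-- Inside a fixed block of `ℵ ^ λ(j)` points, there are infinitely many points which are
distinguished by their contents for all `i < j`. -/
theorem exists_seq_content {j : I} (x : Pt I) :
    ∃ y : ℕ → Pt I, (∀ n, flagOf K (y n) = flagOf K x) ∧
      (j ∈ flagOf K x → ∀ n, content K j (y n) = content K j x) ∧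
      ∀ i, i < j → i ∈ flagOf K x → Function.Injective fun n => content K i (y n) := by
  -- As `λ(j) = δ + 1`, the points at offsets `ℵ ^ δ * n` stay inside one block of length `ℵ ^
  -- λ(j)`.
  set δ : Ordinal.{u} := IsWellFounded.rank (fun j k : I => j < k) j with hδ
  have hlen : aleph I ^ len j = aleph I ^ δ * aleph I := by
    rw [len, Ordinal.opow_add, Ordinal.opow_one]
  have hlt : ∀ n : ℕ, aleph I ^ δ * n < aleph I ^ len j := fun n => by
    rw [hlen, Ordinal.lt_mul_iff_div_lt (pow_ne_zero' _), Ordinal.mul_div_cancel _ (pow_ne_zero' _)]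
    exact natCast_lt_aleph n
  let y : ℕ → Pt I := fun n => glue (len_le j) (quo (len_le j) x) ⟨aleph I ^ δ * n, hlt n⟩
  have hval : ∀ n, (y n).1 = aleph I ^ len j * (x.1 / aleph I ^ len j) + aleph I ^ δ * n :=
    fun n => rfl
  have hquo : ∀ n, (y n).1 / aleph I ^ len j = x.1 / aleph I ^ len j := fun n => by
    rw [hval, Ordinal.mul_add_div _ (pow_ne_zero' _), Ordinal.div_eq_zero_of_lt (hlt n), add_zero]
  have hflag : ∀ n, flagOf K (y n) = flagOf K x := fun n => by
    rw [flagOf_eq_iff, div_div' _ j, div_div' _ j, hquo]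
  refine ⟨y, hflag, fun hj n => ?_, fun i hij hi n m hnm => ?_⟩
  · rw [content_eq_iff K (by rw [hflag]; exact hj) hj]
    exact ⟨fun k _ => by rw [hflag], by rw [middle, middle, hquo]⟩
  · have hle : len i ≤ δ := by
      rw [len]
      exact Order.add_one_le_of_lt (IsWellFounded.rank_lt_of_rel (r := fun j k : I => j < k) hij)
    have h1 := ((content_eq_iff K (by rw [hflag]; exact hi) (by rw [hflag]; exact hi)).1 hnm).2
    have h2 := (flagOf_eq_iff K).1 ((hflag n).trans (hflag m).symm)
    rw [div_div' _ i, div_div' _ i] at h2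
    have h3 : (y n).1 / aleph I ^ len i = (y m).1 / aleph I ^ len i := by
      simp only [middle] at h1
      rw [← Ordinal.div_add_mod ((y n).1 / aleph I ^ len i) (aleph I ^ (krullDim I + 1 - len i)),
        h2, h1, Ordinal.div_add_mod]
    have h4 : ∀ n : ℕ, (y n).1 / aleph I ^ len i =
        aleph I ^ (δ - len i) * (aleph I * (x.1 / aleph I ^ len j) + n) := fun n => by
      rw [hval, hlen, mul_assoc, ← mul_add, ← Ordinal.add_sub_cancel_of_le hle, Ordinal.opow_add,
        Ordinal.add_sub_cancel_of_le hle, mul_assoc, Ordinal.mul_div_cancel _ (pow_ne_zero' _)]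
    rw [h4, h4] at h3
    have h5 := congrArg (· / aleph I ^ (δ - len i)) h3
    simp only [Ordinal.mul_div_cancel _ (pow_ne_zero' (δ - len i))] at h5
    exact_mod_cast (add_right_inj _).1 h5

end Coordinates

end PosetRing

/-! ### Finiteness conditions on rows and entries. -/

namespace CFM

variable {X : Type w} {D : Type v} [Ring D]

open Classical in
theorem idem_entry (Y : Set X) (x y : X) : idem D Y x y = if x = y ∧ x ∈ Y then 1 else 0 := rfl

open Classical in
theorem idem_mul_entry (Y : Set X) (a : CFM X D) (x y : X) :
    (idem D Y * a : CFM X D) x y = if x ∈ Y then a x y else 0 := by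
  rw [mul_entry, finsum_eq_single _ x]
  · by_cases h : x ∈ Y <;> simp [idem_entry, h]
  · intro z hz
    simp [idem_entry, Ne.symm hz]

open Classical in
theorem mul_idem_entry (Y : Set X) (a : CFM X D) (x y : X) :
    (a * idem D Y : CFM X D) x y = if y ∈ Y then a x y else 0 := by
  rw [mul_entry, finsum_eq_single _ y]
  · by_cases h : y ∈ Y <;> simp [idem_entry, h]
  · intro z hz
    simp [idem_entry, hz]

theorem exists_ne_zero_of_mul_entry {a b : CFM X D} {x y : X} (h : (a * b) x y ≠ 0) :
    ∃ z, a x z ≠ 0 ∧ b z y ≠ 0 := by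
  obtain ⟨z, hz⟩ : ∃ z, a x z * b z y ≠ 0 := by
    by_contra h'
    push Not at h'
    exact h (by rw [mul_entry]; simp [h'])
  exact ⟨z, left_ne_zero_of_mul hz, right_ne_zero_of_mul hz⟩

theorem exists_entry_ne_zero {a : CFM X D} (h : a ≠ 0) : ∃ x y, a x y ≠ 0 := by
  by_contra h'
  push Not at h'
  exact h (ext' h')

/-- The matrices all of whose rows have finite support. -/
def rowFinite (X : Type w) (D : Type v) [Ring D] : AddSubgroup (CFM X D) where
  carrier := {a | ∀ x, {y | a x y ≠ 0}.Finite}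
  zero_mem' := by simp
  add_mem' {a b} ha hb x := by
    refine ((ha x).union (hb x)).subset fun y hy => ?_
    by_contra h
    simp only [Set.mem_union, Set.mem_ofPred_eq, not_or, not_not] at h
    exact hy (by rw [add_entry, h.1, h.2, add_zero])
  neg_mem' {a} ha := by simpa using ha

theorem finEntries_le_finRows : finEntries X D ≤ finRows X D := fun _ ha =>
  (Set.Finite.image Prod.fst ha).subset fun x ⟨y, hy⟩ => ⟨(x, y), hy, rfl⟩

theorem finEntries_le_rowFinite : finEntries X D ≤ rowFinite X D := fun _ ha x =>
  (Set.Finite.image Prod.snd ha).subset fun y hy => ⟨(x, y), hy, rfl⟩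

theorem scalar_mem_rowFinite (d : D) : scalar X D d ∈ rowFinite X D := fun x =>
  (Set.finite_singleton x).subset fun y hy => by
    by_contra h
    exact hy (if_neg fun h' => h h'.symm)

theorem mul_mem_finRows_left {a : CFM X D} (ha : a ∈ finRows X D) (b : CFM X D) :
    a * b ∈ finRows X D :=
  Set.Finite.subset ha fun _ ⟨_, hy⟩ =>
    let ⟨z, hz, _⟩ := exists_ne_zero_of_mul_entry hy
    ⟨z, hz⟩

/-- The nonzero rows of the product lie in the supports of finitely many columns of `a`, and these
are finite. -/
theorem mul_mem_finRows_right (a : CFM X D) {b : CFM X D} (hb : b ∈ finRows X D) :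
    a * b ∈ finRows X D :=
  (Set.Finite.biUnion (s := {z | ∃ y, b z y ≠ 0}) hb fun z _ => a.finite_col z).subset
    fun x ⟨y, hy⟩ => by
      obtain ⟨z, hz, hz'⟩ := exists_ne_zero_of_mul_entry hy
      exact Set.mem_biUnion (show z ∈ {z | ∃ y, b z y ≠ 0} from ⟨y, hz'⟩) hz

/-- Each nonzero entry of `a` meets one row of `b`. Column-finiteness says nothing about rows, which
is why `b` has to be row-finite. -/
theorem mul_mem_finEntries_left {a : CFM X D} (ha : a ∈ finEntries X D) {b : CFM X D}
    (hb : b ∈ rowFinite X D) : a * b ∈ finEntries X D :=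
  (Set.Finite.biUnion (s := {p : X × X | a p.1 p.2 ≠ 0}) ha fun p _ =>
    (Set.finite_singleton p.1).prod (hb p.2)).subset fun p hp => by
      obtain ⟨z, hz, hz'⟩ := exists_ne_zero_of_mul_entry hp
      exact Set.mem_biUnion (show (p.1, z) ∈ {p : X × X | a p.1 p.2 ≠ 0} from hz) ⟨rfl, hz'⟩

theorem mul_mem_finEntries_right (a : CFM X D) {b : CFM X D} (hb : b ∈ finEntries X D) :
    a * b ∈ finEntries X D :=
  (Set.Finite.biUnion (s := {p : X × X | b p.1 p.2 ≠ 0}) hb fun p _ =>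
    (a.finite_col p.1).prod (Set.finite_singleton p.2)).subset fun p hp => by
      obtain ⟨z, hz, hz'⟩ := exists_ne_zero_of_mul_entry hp
      exact Set.mem_biUnion (show (z, p.2) ∈ {p : X × X | b p.1 p.2 ≠ 0} from hz') ⟨hz, rfl⟩

theorem idem_singleton_mem_finEntries (x : X) : idem D {x} ∈ finEntries X D :=
  (Set.finite_singleton (x, x)).subset fun p hp => by
    by_contra h
    exact hp (if_neg fun ⟨h1, h2⟩ => h (Prod.ext h2 (h1.symm.trans h2)))

end CFM

/-! ### The embeddings `1 ⊗ m` and the matrices compatible with them. -/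

namespace PosetRing

theorem phi_scalar {I : Type u} [PartialOrder I] {D : Type v} [Ring D] {α : Ordinal.{u}}
    (h : α ≤ krullDim I + 1) (d : D) :
    phi D h (CFM.scalar _ D d) = CFM.scalar _ D d := CFM.ext' fun x y => by
  change (if rem α x = rem α y then CFM.scalarFun d (quo h x) (quo h y) else 0) =
    CFM.scalarFun d x y
  rw [CFM.scalarFun_entry, CFM.scalarFun_entry]
  by_cases hxy : x = y
  · simp [hxy]
  · rw [if_neg hxy]
    split_ifs with h1 h2
    · exact absurd (quo_rem_inj h2 h1) hxy
    · rfl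
    · rfl

variable {I : Type u} [PartialOrder I] [WellFoundedLT I] (K : Choice I)
  {D : Type v} [Ring D]

variable (D) in
/-- The composite `ψ_i ∘ φ_λ(i)`. -/
def embed (i : I) : CFM (Idx I (len i)) D →+ CFM (Pt I) D := (psi K D i).comp (phi D (len_le i))

theorem embed_entry_of_low {i : I} (m : CFM (Idx I (len i)) D) {x y : Pt I} (h : Low K i x y) :
    embed K D i m x y = m (content K i x) (content K i y) := by
  have hx := mem_ptsOf_clsOf K h.1
  have hy := h.mem_ptsOf
  refine (psiEntry_of_mem K (phi D (len_le i) m) hx hy).trans ?_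
  refine (if_pos ?_).trans ?_
  · rw [rem_tMap, rem_tMap, h.2.2.2]
  · rw [quo_tMap, quo_tMap]

theorem embed_entry_of_not_low {i : I} (m : CFM (Idx I (len i)) D) {x y : Pt I}
    (h : ¬ Low K i x y) : embed K D i m x y = 0 := by
  by_cases hc : ∃ c : Cls i, x ∈ ptsOf K.chain c ∧ y ∈ ptsOf K.chain c
  · obtain ⟨c, hx, hy⟩ := hc
    refine (psiEntry_of_mem K (phi D (len_le i) m) hx hy).trans (if_neg ?_)
    rw [rem_tMap, rem_tMap]
    intro hr
    obtain ⟨hx', rfl⟩ := (mem_ptsOf_iff_clsOf K).1 hx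
    obtain ⟨hy', hxy⟩ := (mem_ptsOf_iff_clsOf K).1 hy
    exact h ⟨hx', hy', (clsOf_eq_iff K hx' hy').1 hxy.symm, hr⟩
  · exact psiEntry_of_not K _ hc

theorem low_of_embed_entry_ne_zero {i : I} {m : CFM (Idx I (len i)) D} {x y : Pt I}
    (h : embed K D i m x y ≠ 0) : Low K i x y := by
  by_contra h'
  exact h (embed_entry_of_not_low K m h')

theorem entry_ne_zero_of_embed_entry_ne_zero {i : I} {m : CFM (Idx I (len i)) D} {x y : Pt I}
    (h : embed K D i m x y ≠ 0) : m (content K i x) (content K i y) ≠ 0 := by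
  rwa [embed_entry_of_low K m (low_of_embed_entry_ne_zero K h)] at h

open Classical in
/-- The matrices whose images under `embed` form `H_i`. -/
def core (I' : LowerSet I) (D : Type v) [Ring D] (i : I) :
    AddSubgroup (CFM (Idx I (len i)) D) :=
  if IsMax i then (CFM.scalar _ D).toAddMonoidHom.range
  else if i ∈ I' then CFM.finRows _ D else CFM.finEntries _ D

theorem H_eq_map_core (I' : LowerSet I) (i : I) :
    H K I' D i = (core I' D i).map (embed K D i) := by
  rw [H, core]
  split_ifs with h h'
  · ext a
    simp only [AddSubgroup.mem_map, AddMonoidHom.mem_range]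
    constructor
    · rintro ⟨_, ⟨d, rfl⟩, rfl⟩
      exact ⟨_, ⟨d, rfl⟩, congrArg (psi K D i) (phi_scalar (len_le i) d)⟩
    · rintro ⟨_, ⟨d, rfl⟩, rfl⟩
      exact ⟨_, ⟨d, rfl⟩, (congrArg (psi K D i) (phi_scalar (len_le i) d)).symm⟩
  · rw [F, AddSubgroup.map_map]; rfl
  · rw [G, AddSubgroup.map_map]; rfl

variable {I' : LowerSet I}

theorem core_of_isMax {i : I} (h : IsMax i) :
    core I' D i = (CFM.scalar _ D).toAddMonoidHom.range := if_pos h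

theorem core_le_finRows {i : I} (h : ¬ IsMax i) : core I' D i ≤ CFM.finRows _ D := by
  rw [core, if_neg h]
  split_ifs
  · exact le_rfl
  · exact CFM.finEntries_le_finRows

theorem finEntries_le_core {i : I} (h : ¬ IsMax i) : CFM.finEntries _ D ≤ core I' D i := by
  rw [core, if_neg h]
  split_ifs
  · exact CFM.finEntries_le_finRows
  · exact le_rfl

/-- Scalar and finite matrices are row-finite; only the finite-row matrices, used for `i ∈ I'`, can
fail to be. -/
theorem core_le_rowFinite {i : I} (h : i ∉ I') : core I' D i ≤ CFM.rowFinite _ D := by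
  rw [core]
  split_ifs
  · rintro _ ⟨d, rfl⟩
    exact CFM.scalar_mem_rowFinite d
  · exact CFM.finEntries_le_rowFinite

theorem mul_mem_core_right {i : I} (h : ¬ IsMax i) (a : CFM (Idx I (len i)) D)
    {m : CFM (Idx I (len i)) D} (hm : m ∈ core I' D i) : a * m ∈ core I' D i := by
  rw [core, if_neg h] at hm ⊢
  split_ifs at hm ⊢
  · exact CFM.mul_mem_finRows_right a hm
  · exact CFM.mul_mem_finEntries_right a hm

theorem mul_mem_core_left {i : I} (h : ¬ IsMax i) {a : CFM (Idx I (len i)) D}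
    (ha : i ∉ I' → a ∈ CFM.rowFinite _ D)
    {m : CFM (Idx I (len i)) D} (hm : m ∈ core I' D i) : m * a ∈ core I' D i := by
  rw [core, if_neg h] at hm ⊢
  split_ifs at hm ⊢ with hi
  · exact CFM.mul_mem_finRows_left hm a
  · exact CFM.mul_mem_finEntries_left hm (ha hi)

theorem mul_mem_core {i : I} {m m' : CFM (Idx I (len i)) D} (hm : m ∈ core I' D i)
    (hm' : m' ∈ core I' D i) : m * m' ∈ core I' D i := by
  by_cases h : IsMax i
  · rw [core_of_isMax h] at *
    obtain ⟨d, rfl⟩ := hm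
    obtain ⟨d', rfl⟩ := hm'
    exact ⟨d * d', map_mul (CFM.scalar _ D) d d'⟩
  · exact mul_mem_core_left h (fun hi => core_le_rowFinite hi hm') hm

theorem scalar_mul_mem_core {i : I} {m : CFM (Idx I (len i)) D} (hm : m ∈ core I' D i) (d : D) :
    CFM.scalar _ D d * m ∈ core I' D i := by
  by_cases h : IsMax i
  · exact mul_mem_core (by rw [core_of_isMax h]; exact ⟨d, rfl⟩) hm
  · exact mul_mem_core_right h _ hm

theorem mul_scalar_mem_core {i : I} {m : CFM (Idx I (len i)) D} (hm : m ∈ core I' D i) (d : D) :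
    m * CFM.scalar _ D d ∈ core I' D i := by
  by_cases h : IsMax i
  · exact mul_mem_core hm (by rw [core_of_isMax h]; exact ⟨d, rfl⟩)
  · exact mul_mem_core_left h (fun _ => CFM.scalar_mem_rowFinite d) hm

theorem exists_mem_flagOf (i : I) : ∃ x : Pt I, i ∈ flagOf K x := by
  obtain ⟨A, hA⟩ := Flag.exists_mem i
  obtain ⟨x, rfl⟩ := exists_flagOf_eq K A
  exact ⟨x, hA⟩

/-- The point of `X_i` in the same class and with the same remainder as `x` whose content is
`p`. -/
def lift {i : I} {x : Pt I} (hx : i ∈ flagOf K x) (p : Idx I (len i)) : Pt I :=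
  (exists_low_content_eq K hx p).choose

theorem low_lift {i : I} {x : Pt I} (hx : i ∈ flagOf K x) (p : Idx I (len i)) :
    Low K i x (lift K hx p) := (exists_low_content_eq K hx p).choose_spec.1

theorem content_lift {i : I} {x : Pt I} (hx : i ∈ flagOf K x) (p : Idx I (len i)) :
    content K i (lift K hx p) = p := (exists_low_content_eq K hx p).choose_spec.2

theorem lift_injective {i : I} {x : Pt I} (hx : i ∈ flagOf K x) :
    Function.Injective (lift K hx) := fun p q h => by
  rw [← content_lift K hx p, h, content_lift]

theorem lift_content {i : I} {x y : Pt I} (h : Low K i x y) : lift K h.1 (content K i y) = y :=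
  ((low_lift K h.1 _).symm.trans h).eq_of_content_eq (content_lift K h.1 _)

variable (D) in
/-- The matrices which induce on every set of points of equal class and equal remainder modulo
`ℵ ^ λ(i)` the same matrix. -/
def invariants (i : I) : AddSubgroup (CFM (Pt I) D) where
  carrier := {a | (∀ x y, a x y ≠ 0 → (i ∈ flagOf K x ∨ i ∈ flagOf K y) → Low K i x y) ∧
    ∀ x y x' y', Low K i x y → Low K i x' y' → content K i x = content K i x' →
      content K i y = content K i y' → a x y = a x' y'}
  zero_mem' := ⟨fun _ _ h => absurd rfl h, fun _ _ _ _ _ _ _ _ => rfl⟩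
  add_mem' {a b} ha hb := by
    refine ⟨fun x y h h' => ?_, fun x y x' y' h1 h2 h3 h4 => ?_⟩
    · by_contra hl
      refine h ?_
      rw [CFM.add_entry, not_not.1 fun h => hl (ha.1 x y h h'),
        not_not.1 fun h => hl (hb.1 x y h h'), add_zero]
    · rw [CFM.add_entry, CFM.add_entry, ha.2 x y x' y' h1 h2 h3 h4, hb.2 x y x' y' h1 h2 h3 h4]
  neg_mem' {a} ha := ⟨fun x y h => ha.1 x y (by simpa using h), fun x y x' y' h1 h2 h3 h4 => by
    rw [CFM.neg_entry, CFM.neg_entry, ha.2 x y x' y' h1 h2 h3 h4]⟩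

/-- An entry of `embed K D j m` depends on the relation `Low K j` and on the contents at `j`. Within
a low class at `i`, both are functions of the contents at `i`. -/
theorem embed_mem_invariants {i j : I} (hij : i ≤ j) (m : CFM (Idx I (len j)) D) :
    embed K D j m ∈ invariants K D i := by
  refine ⟨fun x y h h' => ?_, fun x y x' y' h1 h2 h3 h4 => ?_⟩
  · have hl := low_of_embed_entry_ne_zero K h
    rcases h' with h' | h'
    · exact hl.of_le hij h'
    · exact (hl.symm.of_le hij h').symm
  · by_cases hl : Low K j x y
    · have hl' := Low.of_content_eq hij h1.1 h1.2.1 h2 h3 h4 hl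
      rw [embed_entry_of_low K m hl, embed_entry_of_low K m hl',
        content_eq_of_le hij h1.1 h2.1 h3 hl.1, content_eq_of_le hij h1.2.1 h2.2.1 h4 hl.2.1]
    · have hl' : ¬ Low K j x' y' := fun hl' =>
        hl (Low.of_content_eq hij h2.1 h2.2.1 h1 h3.symm h4.symm hl')
      rw [embed_entry_of_not_low K m hl, embed_entry_of_not_low K m hl']

/-- The matrix induced on the points which have the same class and the same remainder as a fixed
point of `X_i`. -/
def restrict {i : I} {x : Pt I} (hx : i ∈ flagOf K x) (a : CFM (Pt I) D) :
    CFM (Idx I (len i)) D :=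
  ⟨fun p q => a (lift K hx p) (lift K hx q), fun q =>
    (a.finite_col (lift K hx q)).preimage (lift_injective K hx).injOn⟩

theorem restrict_entry {i : I} {x : Pt I} (hx : i ∈ flagOf K x) (a : CFM (Pt I) D)
    (p q : Idx I (len i)) : restrict K hx a p q = a (lift K hx p) (lift K hx q) := rfl

theorem restrict_embed {i : I} {x : Pt I} (hx : i ∈ flagOf K x) (m : CFM (Idx I (len i)) D) :
    restrict K hx (embed K D i m) = m := CFM.ext' fun p q => by
  rw [restrict_entry, embed_entry_of_low K m ((low_lift K hx p).symm.trans (low_lift K hx q)),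
    content_lift, content_lift]

theorem embed_injective (i : I) : Function.Injective (embed K D i) := fun m m' h => by
  obtain ⟨x, hx⟩ := exists_mem_flagOf K i
  rw [← restrict_embed K hx m, h, restrict_embed]

theorem restrict_mem_rowFinite {i : I} {x : Pt I} (hx : i ∈ flagOf K x) {a : CFM (Pt I) D}
    (ha : a ∈ CFM.rowFinite _ D) : restrict K hx a ∈ CFM.rowFinite _ D := fun p =>
  (ha (lift K hx p)).preimage (lift_injective K hx).injOn

/-- The support of a row lies in one low class, where the content is injective. -/
theorem embed_mem_rowFinite {i : I} {m : CFM (Idx I (len i)) D} (hm : m ∈ CFM.rowFinite _ D) :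
    embed K D i m ∈ CFM.rowFinite _ D := fun x => by
  refine Set.Finite.of_finite_image (f := content K i) ((hm (content K i x)).subset ?_) ?_
  · rintro _ ⟨y, hy, rfl⟩
    exact entry_ne_zero_of_embed_entry_ne_zero K hy
  · intro y hy y' hy' h
    exact ((low_of_embed_entry_ne_zero K hy).symm.trans
      (low_of_embed_entry_ne_zero K hy')).eq_of_content_eq h

theorem restrict_entry_content {i : I} {x₀ : Pt I} (h₀ : i ∈ flagOf K x₀) {a : CFM (Pt I) D}
    (ha : a ∈ invariants K D i) {x y : Pt I} (h : Low K i x y) :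
    restrict K h₀ a (content K i x) (content K i y) = a x y := by
  rw [restrict_entry]
  exact ha.2 _ _ _ _ ((low_lift K h₀ _).symm.trans (low_lift K h₀ _)) h (content_lift K h₀ _)
    (content_lift K h₀ _)

/-- `lift K hx` parametrises the low class of `x` by contents. -/
theorem finsum_eq_finsum_lift {i : I} {x : Pt I} (hx : i ∈ flagOf K x) (f : Pt I → D)
    (hf : ∀ z, f z ≠ 0 → Low K i x z) : ∑ᶠ z, f z = ∑ᶠ p, f (lift K hx p) := by
  rw [← finsum_mem_range (lift_injective K hx)]
  refine finsum_congr fun z => ?_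
  by_cases h : z ∈ Set.range (lift K hx)
  · simp only [h, finsum_true]
  · simp only [h, finsum_false]
    by_contra h'
    exact h ⟨_, lift_content K (hf z h')⟩

/-- Both factors respect low classes: on `X_i` the product is `(1 ⊗ m)(1 ⊗ r)` with `r = restrict K
h₀ a`, and a path starting in `X_i` cannot leave its low class. -/
theorem embed_mul {i : I} {x₀ : Pt I} (h₀ : i ∈ flagOf K x₀) {a : CFM (Pt I) D}
    (ha : a ∈ invariants K D i) (m : CFM (Idx I (len i)) D) :
    embed K D i m * a = embed K D i (m * restrict K h₀ a) := CFM.ext' fun x y => by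
  by_cases h : Low K i x y
  · rw [embed_entry_of_low K _ h, CFM.mul_entry, CFM.mul_entry, finsum_eq_finsum_lift K h.1]
    · refine finsum_congr fun p => ?_
      have hp := low_lift K h.1 p
      rw [embed_entry_of_low K m hp, ← restrict_entry_content K h₀ ha (hp.symm.trans h),
        content_lift]
    · exact fun z hz => low_of_embed_entry_ne_zero K (left_ne_zero_of_mul hz)
  · rw [embed_entry_of_not_low K _ h]
    by_contra h'
    obtain ⟨z, hz, hz'⟩ := CFM.exists_ne_zero_of_mul_entry h'
    have hl := low_of_embed_entry_ne_zero K hz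
    exact h (hl.trans (ha.1 _ _ hz' (Or.inl hl.2.1)))

theorem mul_embed {i : I} {x₀ : Pt I} (h₀ : i ∈ flagOf K x₀) {a : CFM (Pt I) D}
    (ha : a ∈ invariants K D i) (m : CFM (Idx I (len i)) D) :
    a * embed K D i m = embed K D i (restrict K h₀ a * m) := CFM.ext' fun x y => by
  by_cases h : Low K i x y
  · rw [embed_entry_of_low K _ h, CFM.mul_entry, CFM.mul_entry, finsum_eq_finsum_lift K h.1]
    · refine finsum_congr fun p => ?_
      have hp := low_lift K h.1 p
      rw [embed_entry_of_low K m (hp.symm.trans h), ← restrict_entry_content K h₀ ha hp,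
        content_lift]
    · exact fun z hz => ha.1 _ _ (left_ne_zero_of_mul hz) (Or.inl h.1)
  · rw [embed_entry_of_not_low K _ h]
    by_contra h'
    obtain ⟨z, hz, hz'⟩ := CFM.exists_ne_zero_of_mul_entry h'
    have hl := low_of_embed_entry_ne_zero K hz'
    exact h ((ha.1 _ _ hz (Or.inr hl.1)).trans hl)

theorem embed_mul_embed (i : I) (m m' : CFM (Idx I (len i)) D) :
    embed K D i m * embed K D i m' = embed K D i (m * m') := by
  obtain ⟨x, hx⟩ := exists_mem_flagOf K i
  rw [embed_mul K hx (embed_mem_invariants K le_rfl m'), restrict_embed]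

theorem scalar_mem_invariants (i : I) (d : D) : CFM.scalar _ D d ∈ invariants K D i := by
  refine ⟨fun x y h h' => ?_, fun x y x' y' h1 h2 h3 h4 => ?_⟩
  · obtain rfl : x = y := by
      by_contra hxy
      exact h (if_neg hxy)
    exact Low.refl (h'.elim id id)
  · have : x = y ↔ x' = y' := ⟨fun h => h2.eq_of_content_eq (by rw [← h3, ← h4, h]),
      fun h => h1.eq_of_content_eq (by rw [h3, h4, h])⟩
    change CFM.scalarFun d x y = CFM.scalarFun d x' y'
    rw [CFM.scalarFun_entry, CFM.scalarFun_entry]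
    congr 1
    exact propext this

theorem restrict_scalar {i : I} {x : Pt I} (hx : i ∈ flagOf K x) (d : D) :
    restrict K hx (CFM.scalar _ D d) = CFM.scalar _ D d := CFM.ext' fun p q => by
  change CFM.scalarFun d (lift K hx p) (lift K hx q) = CFM.scalarFun d p q
  rw [CFM.scalarFun_entry, CFM.scalarFun_entry]
  congr 1
  exact propext (lift_injective K hx).eq_iff

theorem embed_one (i : I) : embed K D i 1 = CFM.idem D (pts K.chain i) := CFM.ext' fun x y => by
  rw [CFM.idem_entry, mem_pts_iff]
  by_cases h : Low K i x y
  · rw [embed_entry_of_low K _ h, CFM.one_entry]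
    have : content K i x = content K i y ↔ x = y := ⟨h.eq_of_content_eq, fun h => by rw [h]⟩
    simp only [this, h.1, and_true]
  · rw [embed_entry_of_not_low K _ h, if_neg]
    rintro ⟨rfl, hx⟩
    exact h (Low.refl hx)

theorem mem_spread_block_iff {i : I} (l : Idx I (len i)) {x : Pt I} :
    x ∈ spread K i (block I (len i) l.1) ↔ i ∈ flagOf K x ∧ content K i x = l := by
  simp only [spread, Set.mem_iUnion, Set.mem_image, Set.mem_preimage, Subtype.exists,
    exists_and_right, exists_eq_right, mem_block_iff]
  constructor
  · rintro ⟨c, h, h'⟩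
    exact ⟨((mem_ptsOf_iff_clsOf K).1 h).1, (quo_tMap K h).symm.trans (Subtype.ext h')⟩
  · rintro ⟨h, h'⟩
    refine ⟨_, mem_ptsOf_clsOf K h, ?_⟩
    exact congrArg Subtype.val ((quo_tMap K (mem_ptsOf_clsOf K h)).trans h')

/-- This identifies `e_{Y(i)}` as `1 ⊗` a matrix unit, which is what places it in `H_i` for
non-maximal `i`. -/
theorem embed_idem_singleton (i : I) (l : Idx I (len i)) :
    embed K D i (CFM.idem D {l}) = CFM.idem D (spread K i (block I (len i) l.1)) :=
  CFM.ext' fun x y => by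
    rw [CFM.idem_entry, mem_spread_block_iff]
    by_cases h : Low K i x y
    · rw [embed_entry_of_low K _ h, CFM.idem_entry]
      have : content K i x = content K i y ↔ x = y := ⟨h.eq_of_content_eq, fun h => by rw [h]⟩
      simp only [this, h.1, true_and, Set.mem_singleton_iff]
    · rw [embed_entry_of_not_low K _ h, if_neg]
      rintro ⟨rfl, hx, _⟩
      exact h (Low.refl hx)

end PosetRing

/-! ### Finite sums in a supremum of subgroups. -/

namespace CFM

variable {X : Type w} {D : Type v} [Ring D]

theorem sum_entry {ι : Type*} (s : Finset ι) (f : ι → CFM X D) (x y : X) :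
    (∑ k ∈ s, f k : CFM X D) x y = ∑ k ∈ s, f k x y :=
  map_sum (AddMonoidHom.mk' (fun a : CFM X D => a x y) fun _ _ => rfl) f s

end CFM

/-- The admissible families `f` form a subgroup whose image under summation contains every `H j`
with `j ∈ J`. -/
theorem AddSubgroup.exists_finsupp_of_mem_iSup {ι M : Type*} [AddCommGroup M]
    (H : ι → AddSubgroup M) (J : Set ι) {a : M} (ha : a ∈ ⨆ j ∈ J, H j) :
    ∃ f : ι →₀ M, (∀ j, f j ∈ H j) ∧ (∀ j, j ∉ J → f j = 0) ∧ ∑ j ∈ f.support, f j = a := by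
  classical
  let S : AddSubgroup (ι →₀ M) :=
    { carrier := {f | (∀ j, f j ∈ H j) ∧ ∀ j, j ∉ J → f j = 0}
      zero_mem' := ⟨fun j => (H j).zero_mem, fun _ _ => rfl⟩
      add_mem' := fun {f g} hf hg => ⟨fun j => (H j).add_mem (hf.1 j) (hg.1 j), fun j hj => by
        rw [Finsupp.add_apply, hf.2 j hj, hg.2 j hj, add_zero]⟩
      neg_mem' := fun {f} hf => ⟨fun j => (H j).neg_mem (hf.1 j), fun j hj => by
        rw [Finsupp.neg_apply, hf.2 j hj, neg_zero]⟩ }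
  have hle : ⨆ j ∈ J, H j ≤ S.map (Finsupp.liftAddHom fun _ => AddMonoidHom.id M) := by
    refine iSup₂_le fun j hj b hb => ⟨Finsupp.single j b, ⟨fun k => ?_, fun k hk => ?_⟩, by simp⟩
    · rw [Finsupp.single_apply]
      split_ifs with h
      · exact h ▸ hb
      · exact (H k).zero_mem
    · exact Finsupp.single_eq_of_ne fun h => hk (h ▸ hj)
  obtain ⟨f, hf, rfl⟩ := hle ha
  exact ⟨f, hf.1, hf.2, rfl⟩

/-! ### Products, identities and independence of the `H_i`. -/

namespace PosetRing

variable {I : Type u} [PartialOrder I] [WellFoundedLT I] (K : Choice I)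
  {D : Type v} [Ring D] {I' : LowerSet I}

theorem mem_H_iff {i : I} {a : CFM (Pt I) D} :
    a ∈ H K I' D i ↔ ∃ m ∈ core I' D i, embed K D i m = a := by
  rw [H_eq_map_core, AddSubgroup.mem_map]

theorem embed_mem_H {i : I} {m : CFM (Idx I (len i)) D} (hm : m ∈ core I' D i) :
    embed K D i m ∈ H K I' D i := (mem_H_iff K).2 ⟨m, hm, rfl⟩

theorem low_of_mem_H {i : I} {a : CFM (Pt I) D} (ha : a ∈ H K I' D i) {x y : Pt I}
    (h : a x y ≠ 0) : Low K i x y := by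
  obtain ⟨m, _, rfl⟩ := (mem_H_iff K).1 ha
  exact low_of_embed_entry_ne_zero K h

theorem H_le_invariants {i j : I} (hij : i ≤ j) : H K I' D j ≤ invariants K D i := by
  intro a ha
  obtain ⟨m, _, rfl⟩ := (mem_H_iff K).1 ha
  exact embed_mem_invariants K hij m

/-- As `I'` is a lower set, `i ∉ I'` forces `j ∉ I'` for all `j ≥ i`. -/
theorem H_le_rowFinite {i j : I} (hij : i ≤ j) (hi : i ∉ I') :
    H K I' D j ≤ CFM.rowFinite _ D := by
  intro a ha
  obtain ⟨m, hm, rfl⟩ := (mem_H_iff K).1 ha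
  exact embed_mem_rowFinite K (core_le_rowFinite (fun hj => hi (I'.lower hij hj)) hm)

theorem mul_mem_H {i : I} {a b : CFM (Pt I) D} (ha : a ∈ H K I' D i) (hb : b ∈ H K I' D i) :
    a * b ∈ H K I' D i := by
  obtain ⟨m, hm, rfl⟩ := (mem_H_iff K).1 ha
  obtain ⟨m', hm', rfl⟩ := (mem_H_iff K).1 hb
  rw [embed_mul_embed]
  exact embed_mem_H K (mul_mem_core hm hm')

theorem scalar_mul_mem_H {i : I} {a : CFM (Pt I) D} (ha : a ∈ H K I' D i) (d : D) :
    CFM.scalar _ D d * a ∈ H K I' D i := by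
  obtain ⟨x, hx⟩ := exists_mem_flagOf K i
  obtain ⟨m, hm, rfl⟩ := (mem_H_iff K).1 ha
  rw [mul_embed K hx (scalar_mem_invariants K i d), restrict_scalar]
  exact embed_mem_H K (scalar_mul_mem_core hm d)

theorem mul_scalar_mem_H {i : I} {a : CFM (Pt I) D} (ha : a ∈ H K I' D i) (d : D) :
    a * CFM.scalar _ D d ∈ H K I' D i := by
  obtain ⟨x, hx⟩ := exists_mem_flagOf K i
  obtain ⟨m, hm, rfl⟩ := (mem_H_iff K).1 ha
  rw [embed_mul K hx (scalar_mem_invariants K i d), restrict_scalar]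
  exact embed_mem_H K (mul_scalar_mem_core hm d)

/-- A nonzero entry of the product passes through a point whose chain contains both `i` and `j`. -/
theorem mul_eq_zero_of_not_comparable {i j : I} (hij : ¬ i ≤ j) (hji : ¬ j ≤ i)
    {a b : CFM (Pt I) D} (ha : a ∈ H K I' D i) (hb : b ∈ H K I' D j) : a * b = 0 := by
  by_contra h
  obtain ⟨x, y, hxy⟩ := CFM.exists_entry_ne_zero h
  obtain ⟨z, hz, hz'⟩ := CFM.exists_ne_zero_of_mul_entry hxy
  exact ((flagOf K z).le_or_le (low_of_mem_H K ha hz).2.1 (low_of_mem_H K hb hz').1).elim hij hji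

theorem idem_pts_mem_H {i : I} (h : IsMax i) : CFM.idem D (pts K.chain i) ∈ H K I' D i := by
  rw [← embed_one]
  refine embed_mem_H K ?_
  rw [core_of_isMax h]
  exact ⟨1, map_one (CFM.scalar _ D)⟩

theorem idem_pts_mul {i : I} {a : CFM (Pt I) D} (ha : a ∈ H K I' D i) :
    CFM.idem D (pts K.chain i) * a = a := by
  obtain ⟨m, _, rfl⟩ := (mem_H_iff K).1 ha
  rw [← embed_one, embed_mul_embed, one_mul]

theorem mul_idem_pts {i : I} {a : CFM (Pt I) D} (ha : a ∈ H K I' D i) :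
    a * CFM.idem D (pts K.chain i) = a := by
  obtain ⟨m, _, rfl⟩ := (mem_H_iff K).1 ha
  rw [← embed_one, embed_mul_embed, mul_one]

/-- An element above `i` gives `λ(i) < ξ + 1`, so the exponent of `ℵ` is at least `1`. -/
theorem infinite_idx {i : I} (h : ¬ IsMax i) : Infinite (Idx I (len i)) := by
  obtain ⟨j, hij⟩ := not_isMax_iff.1 h
  have h1 : 1 ≤ krullDim I + 1 - len i := by
    rw [Order.one_le_iff_ne_zero]
    intro h0
    exact ((len_lt_len hij).trans_le (len_le j)).not_ge (Ordinal.sub_eq_zero_iff_le.1 h0)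
  have h2 : 1 ≤ beth I := by
    obtain ⟨A, _⟩ := Flag.exists_mem i
    have : Nonempty (Flag I) := ⟨A⟩
    rw [Order.one_le_iff_ne_zero, beth, Ne, Cardinal.ord_eq_zero]
    exact Cardinal.mk_ne_zero _
  have h3 : aleph I ≤ aleph I ^ (krullDim I + 1 - len i) * beth I := by
    have := mul_le_mul' (Ordinal.opow_le_opow_right (a := aleph I)
      (pos_iff_ne_zero.2 aleph_ne_zero) h1) h2
    rwa [Ordinal.opow_one, mul_one] at this
  exact Infinite.of_injective (fun n : ℕ => (⟨n, (natCast_lt_aleph n).trans_le h3⟩ : Idx I (len i)))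
    fun n m h => by simpa using congrArg Subtype.val h

/-- For non-maximal `i` the matrix of `e` has only finitely many nonzero rows among infinitely many.
If row `p` vanishes, `e` does not fix the image of the matrix unit at `(p, p)`. -/
theorem isMax_of_exists_one [Nontrivial D] {i : I} {e : CFM (Pt I) D} (he : e ∈ H K I' D i)
    (h : ∀ a ∈ H K I' D i, e * a = a) : IsMax i := by
  by_contra hi
  obtain ⟨m, hm, rfl⟩ := (mem_H_iff K).1 he
  have := infinite_idx hi
  obtain ⟨p, hp⟩ := Set.Infinite.nonempty (Set.Finite.infinite_compl (core_le_finRows hi hm))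
  have h1 := h _ (embed_mem_H K (finEntries_le_core hi (CFM.idem_singleton_mem_finEntries p)))
  rw [embed_mul_embed] at h1
  have h2 := congrArg (fun b : CFM (Idx I (len i)) D => b p p) (embed_injective K i h1)
  simp only [CFM.mul_idem_entry, CFM.idem_entry, Set.mem_singleton_iff, and_self, if_true] at h2
  exact hp ⟨p, by rw [h2]; exact one_ne_zero⟩

theorem one_mem_H_iff [Nontrivial D] {i : I} : (1 : CFM (Pt I) D) ∈ H K I' D i ↔ IsTop i := by
  constructor
  · intro h j
    have hi : IsMax i := isMax_of_exists_one K h fun a _ => one_mul a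
    obtain ⟨x, hx⟩ := exists_mem_flagOf K j
    have hxi : Low K i x x := low_of_mem_H K h (by
      rw [CFM.one_entry, if_pos rfl]
      exact one_ne_zero)
    rcases (flagOf K x).le_or_le hx hxi.1 with h' | h'
    · exact h'
    · exact hi h'
  · intro h
    have h1 : (1 : CFM (Pt I) D) = CFM.idem D (pts K.chain i) := CFM.ext' fun x y => by
      have hx : x ∈ pts K.chain i := (mem_pts_iff K).2
        (Flag.mem_iff_forall_le_or_ge.2 fun j _ => Or.inr (h j))
      rw [CFM.one_entry, CFM.idem_entry]
      congr 1
      simp [hx]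
    rw [h1]
    exact idem_pts_mem_H K h.isMax

/-- A nonzero finite sum of elements of the `H_j` has a nonzero entry in a row indexed by a point
of `X_i`, for all `i` below a suitable index of the sum. -/
theorem exists_sum_entry_ne_zero (f : I →₀ CFM (Pt I) D) (hf : ∀ j, f j ∈ H K I' D j)
    (h0 : f ≠ 0) : ∃ j, f j ≠ 0 ∧ ∀ i, i ≤ j →
      ∃ x y, i ∈ flagOf K x ∧ (∑ k ∈ f.support, f k : CFM (Pt I) D) x y ≠ 0 := by
  classical
  obtain ⟨j, hj, hmax⟩ := f.support.exists_maximal (Finsupp.support_nonempty_iff.2 h0)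
  have hj0 := Finsupp.mem_support_iff.1 hj
  refine ⟨j, hj0, fun i hij => ?_⟩
  obtain ⟨m, hm, hmj⟩ := (mem_H_iff K).1 (hf j)
  have hm0 : m ≠ 0 := by
    rintro rfl
    exact hj0 (by rw [← hmj, map_zero])
  obtain ⟨p, q, hpq⟩ := CFM.exists_entry_ne_zero hm0
  -- Working on a chain through both `i` and `j` puts the final row into `X_i`.
  obtain ⟨A, hiA, hjA⟩ := Flag.exists_mem_mem hij
  obtain ⟨x₀, rfl⟩ := exists_flagOf_eq K A
  obtain ⟨x₁, hx₁, hp⟩ := exists_low_content_eq K hjA p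
  have hi₁ : i ∈ flagOf K x₁ := (hx₁.2.2.1 i hij).1 hiA
  obtain ⟨x, hflag, hcont, hinj⟩ := exists_seq_content (K := K) (j := j) x₁
  have hfin : ∀ k ∈ f.support.erase j, {n | ∃ y, f k (x n) y ≠ 0}.Finite := by
    intro k hk
    obtain ⟨hkj, hk⟩ := Finset.mem_erase.1 hk
    obtain ⟨mk, hmk, hk'⟩ := (mem_H_iff K).1 (hf k)
    by_cases hlt : k ∈ flagOf K x₁
    · have hkj' : k < j := by
        refine lt_of_le_of_ne ?_ hkj
        rcases (flagOf K x₁).le_or_le hlt hx₁.2.1 with h | h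
        · exact h
        · exact hmax hk h
      refine ((core_le_finRows (fun h => hkj'.not_isMax h) hmk).preimage
        (hinj k hkj' hlt).injOn).subset ?_
      rintro n ⟨y, hy⟩
      rw [← hk'] at hy
      exact ⟨_, entry_ne_zero_of_embed_entry_ne_zero K hy⟩
    · refine Set.finite_empty.subset ?_
      rintro n ⟨y, hy⟩
      have := (low_of_mem_H K (hf k) hy).1
      rw [hflag] at this
      exact hlt this
  obtain ⟨n, hn⟩ := (Set.Finite.infinite_compl
    (Set.Finite.biUnion (f.support.erase j).finite_toSet hfin)).nonempty
  have hjn : j ∈ flagOf K (x n) := by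
    rw [hflag]; exact hx₁.2.1
  obtain ⟨y, hy, hq⟩ := exists_low_content_eq K hjn q
  refine ⟨x n, y, by rwa [hflag], ?_⟩
  rw [CFM.sum_entry, Finset.sum_eq_single_of_mem j hj, ← hmj, embed_entry_of_low K m hy,
    hcont hx₁.2.1, hp, hq]
  · exact hpq
  · intro k hk hkj
    by_contra h
    exact hn (Set.mem_biUnion (Finset.mem_coe.2 (Finset.mem_erase.2 ⟨hkj, hk⟩)) ⟨y, h⟩)

theorem iSupIndep_H : iSupIndep fun i => H K I' D i := by
  classical
  intro i
  rw [AddSubgroup.disjoint_def]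
  intro a ha ha'
  obtain ⟨f, hf, hf', hfa⟩ := AddSubgroup.exists_finsupp_of_mem_iSup
    (fun j => H K I' D j) {j | j ≠ i} ha'
  by_contra h0
  -- The relation `f - a` is nonzero, because its `i`-th term is `-a`, yet sums to zero.
  let f' : I →₀ CFM (Pt I) D := f - Finsupp.single i a
  have hsum : ∑ k ∈ f'.support, f' k = 0 := by
    have : f'.sum (fun _ b => b) = f.sum (fun _ b => b) - a := by
      rw [Finsupp.sum_sub_index fun _ _ _ => rfl, Finsupp.sum_single_index rfl]
    exact this.trans (sub_eq_zero.2 hfa)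
  have hi : f' i = -a := by
    rw [Finsupp.sub_apply, hf' i (by simp), Finsupp.single_eq_same, zero_sub]
  have hf'H : ∀ j, f' j ∈ H K I' D j := fun j => by
    rw [Finsupp.sub_apply, Finsupp.single_apply]
    refine sub_mem (hf j) ?_
    split_ifs with h
    · exact h ▸ ha
    · exact zero_mem _
  have hne : f' ≠ 0 := fun h => h0 (by
    rw [h] at hi
    exact neg_eq_zero.1 hi.symm)
  obtain ⟨j, _, hj⟩ := exists_sum_entry_ne_zero K f' hf'H hne
  obtain ⟨x, y, _, hxy⟩ := hj j le_rfl
  rw [hsum] at hxy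
  exact hxy rfl

/-! ### Multiplying `H_i` by sums of elements of `H_j` with `j ≥ i`. -/

section Above

variable {K} {i : I} {J : Set I} (hJ : J ⊆ Set.Ici i) {a : CFM (Pt I) D}
  (ha : a ∈ ⨆ j ∈ J, H K I' D j)

include hJ ha

theorem mem_invariants_of_mem_iSup : a ∈ invariants K D i :=
  (iSup₂_le fun _ hj => H_le_invariants K (hJ hj) : ⨆ j ∈ J, H K I' D j ≤ _) ha

theorem mem_H_of_isMax (hi : IsMax i) : a ∈ H K I' D i :=
  (iSup₂_le fun _ hj => (hi.eq_of_le (hJ hj)).symm ▸ le_rfl : ⨆ j ∈ J, H K I' D j ≤ _) ha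

theorem mul_mem_H_of_mem_iSup {b : CFM (Pt I) D} (hb : b ∈ H K I' D i) :
    b * a ∈ H K I' D i := by
  by_cases hi : IsMax i
  · exact mul_mem_H K hb (mem_H_of_isMax hJ ha hi)
  · obtain ⟨x, hx⟩ := exists_mem_flagOf K i
    obtain ⟨m, hm, rfl⟩ := (mem_H_iff K).1 hb
    rw [embed_mul K hx (mem_invariants_of_mem_iSup hJ ha)]
    refine embed_mem_H K (mul_mem_core_left hi (fun hi' => restrict_mem_rowFinite K hx ?_) hm)
    exact (iSup₂_le fun _ hj => H_le_rowFinite K (hJ hj) hi' : ⨆ j ∈ J, H K I' D j ≤ _) ha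

theorem mul_mem_H_of_mem_iSup' {b : CFM (Pt I) D} (hb : b ∈ H K I' D i) :
    a * b ∈ H K I' D i := by
  by_cases hi : IsMax i
  · exact mul_mem_H K (mem_H_of_isMax hJ ha hi) hb
  · obtain ⟨x, hx⟩ := exists_mem_flagOf K i
    obtain ⟨m, hm, rfl⟩ := (mem_H_iff K).1 hb
    rw [mul_embed K hx (mem_invariants_of_mem_iSup hJ ha)]
    exact embed_mem_H K (mul_mem_core_right hi _ hm)

/-- The isolated term has index `j ≥ i`, so a nonzero row can be found in `X_i`; invariance then
forces the column into `X_i`. -/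
theorem exists_entry_ne_zero_of_mem_iSup (h0 : a ≠ 0) :
    ∃ x y, i ∈ flagOf K x ∧ i ∈ flagOf K y ∧ a x y ≠ 0 := by
  have hinv := mem_invariants_of_mem_iSup hJ ha
  obtain ⟨f, hf, hfJ, rfl⟩ := AddSubgroup.exists_finsupp_of_mem_iSup _ J ha
  have hne : f ≠ 0 := by
    rintro rfl
    exact h0 (by simp)
  obtain ⟨j, hj, h⟩ := exists_sum_entry_ne_zero K f hf hne
  have hij : i ≤ j := hJ (by
    by_contra hjJ
    exact hj (hfJ j hjJ))
  obtain ⟨x, y, hx, hxy⟩ := h i hij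
  exact ⟨x, y, hx, (hinv.1 x y hxy (Or.inl hx)).2.1, hxy⟩

end Above

theorem idem_spread_block_mem_H {i : I} (hi : ¬ IsMax i) (l : Idx I (len i)) :
    CFM.idem D (spread K i (block I (len i) l.1)) ∈ H K I' D i := by
  rw [← embed_idem_singleton]
  exact embed_mem_H K (finEntries_le_core hi (CFM.idem_singleton_mem_finEntries l))

end PosetRing

end

theorem mainTheorem2 {I : Type*} [PartialOrder I] [WellFoundedLT I] [Nontrivial I]
    (I' : LowerSet I) {D : Type*} [Ring D] [Nontrivial D] (K : PosetRing.Choice I) :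
    -- every `H i` is a `(D, D)`-submodule, and the family of these submodules is independent
    (∀ i, ∀ a ∈ PosetRing.H K I' D i, ∀ d : D,
      CFM.scalar _ D d * a ∈ PosetRing.H K I' D i ∧
        a * CFM.scalar _ D d ∈ PosetRing.H K I' D i) ∧
    iSupIndep (fun i => PosetRing.H K I' D i) ∧
    -- every `H i` is closed under multiplication
    (∀ i, ∀ a ∈ PosetRing.H K I' D i, ∀ b ∈ PosetRing.H K I' D i,
      a * b ∈ PosetRing.H K I' D i) ∧
    -- `H i` contains the identity of the whole ring iff `i` is the greatest element
    (∀ i, (1 : CFM (PosetRing.Pt I) D) ∈ PosetRing.H K I' D i ↔ IsTop i) ∧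
    -- `H i` has an identity iff `i` is maximal, and then it is the idempotent of `X_i`
    (∀ i, (∃ e ∈ PosetRing.H K I' D i, ∀ a ∈ PosetRing.H K I' D i, e * a = a ∧ a * e = a) ↔
      IsMax i) ∧
    (∀ i, IsMax i → CFM.idem D (PosetRing.pts K.chain i) ∈ PosetRing.H K I' D i ∧
      ∀ a ∈ PosetRing.H K I' D i,
        CFM.idem D (PosetRing.pts K.chain i) * a = a ∧
          a * CFM.idem D (PosetRing.pts K.chain i) = a) ∧
    -- products of incomparable members vanish
    (∀ i j, ¬ i ≤ j → ¬ j ≤ i →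
      ∀ a ∈ PosetRing.H K I' D i, ∀ b ∈ PosetRing.H K I' D j, a * b = 0) ∧
    -- multiplication by nonzero elements supported above `i`
    (∀ i, ∀ J : Set I, J ⊆ Set.Ici i → ∀ a ∈ ⨆ j ∈ J, PosetRing.H K I' D j, a ≠ 0 →
      (∃ b ∈ PosetRing.H K I' D i, b * a ≠ 0) ∧
      (∀ b ∈ PosetRing.H K I' D i, b * a ∈ PosetRing.H K I' D i) ∧
      (∃ b ∈ PosetRing.H K I' D i, a * b ≠ 0) ∧
      (∀ b ∈ PosetRing.H K I' D i, a * b ∈ PosetRing.H K I' D i) ∧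
      (∃ Y ∈ PosetRing.blocks I (PosetRing.len i),
        CFM.idem D (PosetRing.spread K i Y) * a ≠ 0 ∧
        (¬ IsMax i → CFM.idem D (PosetRing.spread K i Y) ∈ PosetRing.H K I' D i ∧
          CFM.idem D (PosetRing.spread K i Y) * a ∈ PosetRing.H K I' D i)) ∧
      (∃ Z ∈ PosetRing.blocks I (PosetRing.len i),
        a * CFM.idem D (PosetRing.spread K i Z) ≠ 0 ∧
        (¬ IsMax i → CFM.idem D (PosetRing.spread K i Z) ∈ PosetRing.H K I' D i ∧
          a * CFM.idem D (PosetRing.spread K i Z) ∈ PosetRing.H K I' D i))) := by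
  open PosetRing in
  refine ⟨fun i a ha d => ⟨scalar_mul_mem_H K ha d, mul_scalar_mem_H K ha d⟩, iSupIndep_H K,
    fun i a ha b hb => mul_mem_H K ha hb, fun i => one_mem_H_iff K, fun i => ?_,
    fun i hi => ⟨idem_pts_mem_H K hi, fun a ha => ⟨idem_pts_mul K ha, mul_idem_pts K ha⟩⟩,
    fun i j hij hji a ha b hb => mul_eq_zero_of_not_comparable K hij hji ha hb, ?_⟩
  · constructor
    · rintro ⟨e, he, h⟩
      exact isMax_of_exists_one K he fun a ha => (h a ha).1
    · exact fun hi => ⟨_, idem_pts_mem_H K hi, fun a ha => ⟨idem_pts_mul K ha, mul_idem_pts K ha⟩⟩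
  · intro i J hJ a ha h0
    -- This one entry settles every nonvanishing claim: an idempotent whose set contains `x` (on the
    -- left) or `y` (on the right) preserves it.
    obtain ⟨x, y, hx, hy, hxy⟩ := exists_entry_ne_zero_of_mem_iSup hJ ha h0
    have hleft : ∀ Y : Set (Pt I), x ∈ Y → CFM.idem D Y * a ≠ 0 := fun Y hY h => hxy (by
      have := congrArg (fun b : CFM (Pt I) D => b x y) h
      simpa only [CFM.idem_mul_entry, hY, if_true, CFM.zero_entry] using this)
    have hright : ∀ Z : Set (Pt I), y ∈ Z → a * CFM.idem D Z ≠ 0 := fun Z hZ h => hxy (by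
      have := congrArg (fun b : CFM (Pt I) D => b x y) h
      simpa only [CFM.mul_idem_entry, hZ, if_true, CFM.zero_entry] using this)
    have hY := (mem_spread_block_iff K (content K i x)).2 ⟨hx, rfl⟩
    have hZ := (mem_spread_block_iff K (content K i y)).2 ⟨hy, rfl⟩
    refine ⟨?_, fun b hb => mul_mem_H_of_mem_iSup hJ ha hb, ?_,
      fun b hb => mul_mem_H_of_mem_iSup' hJ ha hb,
      ⟨_, ⟨content K i x, rfl⟩, hleft _ hY, fun hi => ?_⟩,
      ⟨_, ⟨content K i y, rfl⟩, hright _ hZ, fun hi => ?_⟩⟩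
    · by_cases hi : IsMax i
      · exact ⟨_, idem_pts_mem_H K hi, hleft _ ((mem_pts_iff K).2 hx)⟩
      · exact ⟨_, idem_spread_block_mem_H K hi (content K i x), hleft _ hY⟩
    · by_cases hi : IsMax i
      · exact ⟨_, idem_pts_mem_H K hi, hright _ ((mem_pts_iff K).2 hy)⟩
      · exact ⟨_, idem_spread_block_mem_H K hi (content K i y), hright _ hZ⟩
    · have h := idem_spread_block_mem_H (I' := I') (D := D) K hi (content K i x)
      exact ⟨h, mul_mem_H_of_mem_iSup hJ ha h⟩
    · have h := idem_spread_block_mem_H (I' := I') (D := D) K hi (content K i y)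
      exact ⟨h, mul_mem_H_of_mem_iSup' hJ ha h⟩
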